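/- Let $d\ge 1$, let $\Omega\subset\mathbb{R}^d$ be a bounded open set, and let $a$ be a measurable field of symmetric $d\times d$ matrices on $\Omega$ such that, for almost every $x\in\Omega$ and all $l\in\mathbb{R}^d$, $\lambda_{\min}(a)|l|^2\le l^T a(x)\,l\le\lambda_{\max}(a)|l|^2$, with $\lambda_{\min}(a)>0$. On $H^1_0(\Omega)$ (the closure of $C_c^\infty(\Omega)$ in $H^1(\Omega)$) put $\langle v,w\rangle_a=\int_\Omega(\nabla v)^Ta\nabla w$ and $\|v\|_a=\langle v,v\rangle_a^{1/2}$. For $g\in L^2(\Omega)$ the problem $-\operatorname{div}(a\nabla u)=g$ in $\Omega$, $u=0$ on $\partial\Omega$, has a unique weak solution $u\in H^1_0(\Omega)$, meaning $\langle v,u\rangle_a=\int_\Omega gv$ for all $v\in H^1_0(\Omega)$; write $u=\mathcal{L}^{-1}g$. Call a finite family $(\tau_i)_{i}$ of convex subsets of $\Omega$ of positive volume a convex partition of $\Omega$ of mesh at most $H$ if the $\tau_i$ are pairwise disjoint and cover $\Omega$, both up to sets of measure zero, and each $\tau_i$ has diameter at most $H$. Let $\phi_i$ be the indicator function of $\tau_i$.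 The gamblet $\psi_i$ is a minimizer of $\|\psi\|_a$ over all $\psi\in H^1_0(\Omega)$ with $\int_\Omega\phi_j\psi=\delta_{i,j}$ for all $j$. **One level.** Let $(\tau_i)_i$ be a convex partition of $\Omega$ of mesh at most $H$. Then the gamblets $\psi_i$ exist and are unique, and for every $g\in L^2(\Omega)$, with $u=\mathcal{L}^{-1}g$, $$\inf_{v\in\operatorname{span}\{\psi_i\}}\|u-v\|_a\le\frac{2}{\pi\sqrt{\lambda_{\min}(a)}}\,H\,\|g\|_{L^2(\Omega)},$$ and the infimum is attained at $v=u^*:=\sum_i\psi_i\int_\Omega u\,\phi_i\in\operatorname{span}\{\psi_i\}$. **Several levels.** Let $\mathcal{I}$ be a finite set of $q$-tuples of positive integers and, for $1\le k\le q$, let $\mathcal{I}^{(k)}$ be the set of truncations $(i_1,\dots,i_k)$ of its elements. For $1\le k\le q$ let $(\tau_i^{(k)})_{i\in\mathcal{I}^{(k)}}$ be a convex partition of $\Omega$ of mesh at most $H_k$, and suppose that for $1\le k<q$ and $i\in\mathcal{I}^{(k)}$ the set $\tau_i^{(k)}$ is, up to a set of measure zero, the union of the $\tau_j^{(k+1)}$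 over those $j\in\mathcal{I}^{(k+1)}$ whose truncation to length $k$ is $i$. Let $\phi_i^{(k)}$ be the indicator function of $\tau_i^{(k)}$, let $\psi_i^{(k)}$, $i\in\mathcal{I}^{(k)}$, be the corresponding gamblets, and put $\mathfrak{V}^{(k)}=\operatorname{span}\{\psi_i^{(k)}: i\in\mathcal{I}^{(k)}\}$ for $1\le k\le q$ and $\mathfrak{V}^{(q+1)}=H^1_0(\Omega)$. Then for every $k\in\{1,\dots,q\}$: 1. $\mathfrak{V}^{(k)}\subset\mathfrak{V}^{(k+1)}$ and $\mathfrak{V}^{(k)}=\operatorname{span}\{\mathcal{L}^{-1}\phi_i^{(k)}: i\in\mathcal{I}^{(k)}\}$; 2. for every $g\in L^2(\Omega)$, with $u=\mathcal{L}^{-1}g$ and $u^{(k)}:=\sum_{i\in\mathcal{I}^{(k)}}\psi_i^{(k)}\int_\Omega u\,\phi_i^{(k)}\in\mathfrak{V}^{(k)}$, $$\|u-u^{(k)}\|_a=\inf_{v\in\mathfrak{V}^{(k)}}\|u-v\|_a\le\frac{2}{\pi\sqrt{\lambda_{\min}(a)}}\,H_k\,\|g\|_{L^2(\Omega)}.$$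 -/

import Mathlib

open MeasureTheory
open scoped ContDiff Matrix

noncomputable section

namespace Gamblet

/-- The Hilbert space `L²(Ω)` of real functions on `Ω ⊆ ℝ^d`. -/
abbrev L2 {d : ℕ} (Ω : Set (EuclideanSpace ℝ (Fin d))) : Type :=
  Lp ℝ 2 (volume.restrict Ω)

/-- The Hilbert space `L²(Ω; ℝ^d)` of vector fields on `Ω ⊆ ℝ^d`. -/
abbrev L2Vec {d : ℕ} (Ω : Set (EuclideanSpace ℝ (Fin d))) : Type :=
  Lp (EuclideanSpace ℝ (Fin d)) 2 (volume.restrict Ω)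

/-- Pairs `(u, G)` with `u ∈ L²(Ω)`, `G ∈ L²(Ω; ℝ^d)`, with the Hilbert norm
`(‖u‖² + ‖G‖²)^(1/2)`. On pairs `(u, ∇u)` this is the `H¹(Ω)` norm of `u`. -/
abbrev L2Pair {d : ℕ} (Ω : Set (EuclideanSpace ℝ (Fin d))) : Type :=
  WithLp 2 (L2 Ω × L2Vec Ω)

/-- The subspace of the pairs `(η, ∇η)` with `η ∈ C_c^∞(Ω)`. -/
def testPairs {d : ℕ} (Ω : Set (EuclideanSpace ℝ (Fin d))) : Submodule ℝ (L2Pair Ω) where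
  carrier := {p | ∃ η : EuclideanSpace ℝ (Fin d) → ℝ,
    ContDiff ℝ ∞ η ∧ HasCompactSupport η ∧ tsupport η ⊆ Ω ∧
    p.fst =ᵐ[volume.restrict Ω] η ∧ p.snd =ᵐ[volume.restrict Ω] gradient η}
  zero_mem' := by
    refine ⟨0, contDiff_const, HasCompactSupport.zero, by simp, ?_, ?_⟩
    · exact Lp.coeFn_zero _ _ _
    · have h : gradient (0 : EuclideanSpace ℝ (Fin d) → ℝ) = 0 := by
        funext x
        exact gradient_fun_const x (0 : ℝ)
      rw [h]
      exact Lp.coeFn_zero _ _ _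
  add_mem' := by
    rintro p p' ⟨η, h1, h2, h3, h4, h5⟩ ⟨η', h1', h2', h3', h4', h5'⟩
    refine ⟨η + η', h1.add h1', h2.add h2', ?_, ?_, ?_⟩
    · exact (tsupport_add η η').trans (Set.union_subset h3 h3')
    · filter_upwards [Lp.coeFn_add p.fst p'.fst, h4, h4'] with x hx hy hz
      rw [WithLp.add_fst, hx, Pi.add_apply, hy, hz, Pi.add_apply]
    · filter_upwards [Lp.coeFn_add p.snd p'.snd, h5, h5'] with x hx hy hz
      have hd : DifferentiableAt ℝ η x := (h1.differentiable (by simp)) x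
      have hd' : DifferentiableAt ℝ η' x := (h1'.differentiable (by simp)) x
      rw [WithLp.add_snd, hx, Pi.add_apply, hy, hz]
      simp only [gradient]
      rw [fderiv_add hd hd', map_add]
  smul_mem' := by
    rintro c p ⟨η, h1, h2, h3, h4, h5⟩
    refine ⟨c • η, contDiff_const.smul h1, h2.smul_left (f := fun _ => c), ?_, ?_, ?_⟩
    · exact (closure_mono (Function.support_const_smul_subset c η)).trans h3
    · filter_upwards [Lp.coeFn_smul c p.fst, h4] with x hx hy
      simp [hx, hy]
    · filter_upwards [Lp.coeFn_smul c p.snd, h5] with x hx hy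
      have hd : DifferentiableAt ℝ η x := (h1.differentiable (by simp)) x
      rw [WithLp.smul_snd, hx, Pi.smul_apply, hy]
      simp only [gradient]
      rw [fderiv_const_smul hd, map_smul]

/-- The Sobolev space `H¹₀(Ω)`, the closure of `C_c^∞(Ω)` in the `H¹(Ω)` norm. A function
`u ∈ H¹₀(Ω)` is recorded together with its weak gradient, as the pair `(u, ∇u)`; the second
component is determined by the first. -/
def H10 {d : ℕ} (Ω : Set (EuclideanSpace ℝ (Fin d))) : Submodule ℝ (L2Pair Ω) :=
  (testPairs Ω).topologicalClosure

/-- The function underlying an element of `H¹₀(Ω)`. -/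
def val {d : ℕ} {Ω : Set (EuclideanSpace ℝ (Fin d))} (u : H10 Ω) : L2 Ω :=
  (u : L2Pair Ω).fst

/-- The weak gradient of an element of `H¹₀(Ω)`. -/
def grad {d : ℕ} {Ω : Set (EuclideanSpace ℝ (Fin d))} (u : H10 Ω) : L2Vec Ω :=
  (u : L2Pair Ω).snd

/-- `a` is a measurable field of symmetric matrices on `Ω`, uniformly elliptic and bounded:
`lmin |l|² ≤ lᵀ a(x) l ≤ lmax |l|²` for almost every `x ∈ Ω` and all `l`, with `lmin > 0`. -/
structure IsElliptic {d : ℕ} (Ω : Set (EuclideanSpace ℝ (Fin d)))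
    (a : EuclideanSpace ℝ (Fin d) → Matrix (Fin d) (Fin d) ℝ) (lmin lmax : ℝ) : Prop where
  pos : 0 < lmin
  measurable : ∀ i j, AEStronglyMeasurable (fun x => a x i j) (volume.restrict Ω)
  symm : ∀ᵐ x ∂(volume.restrict Ω), (a x).IsSymm
  lower : ∀ᵐ x ∂(volume.restrict Ω), ∀ l : Fin d → ℝ,
    lmin * (l ⬝ᵥ l) ≤ l ⬝ᵥ (a x *ᵥ l)
  upper : ∀ᵐ x ∂(volume.restrict Ω), ∀ l : Fin d → ℝ,
    l ⬝ᵥ (a x *ᵥ l) ≤ lmax * (l ⬝ᵥ l)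

/-- The energy scalar product `⟨v, w⟩_a = ∫_Ω (∇v)ᵀ a ∇w`. -/
def energyInner {d : ℕ} {Ω : Set (EuclideanSpace ℝ (Fin d))}
    (a : EuclideanSpace ℝ (Fin d) → Matrix (Fin d) (Fin d) ℝ) (v w : H10 Ω) : ℝ :=
  ∫ x in Ω, (grad v x).ofLp ⬝ᵥ (a x *ᵥ (grad w x).ofLp)

/-- The energy norm `‖v‖_a = (∫_Ω (∇v)ᵀ a ∇v)^(1/2)`. -/
def energyNorm {d : ℕ} {Ω : Set (EuclideanSpace ℝ (Fin d))}
    (a : EuclideanSpace ℝ (Fin d) → Matrix (Fin d) (Fin d) ℝ) (v : H10 Ω) : ℝ :=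
  Real.sqrt (energyInner a v v)

/-- `u ∈ H¹₀(Ω)` is the weak solution of `-div(a ∇u) = g` in `Ω`, `u = 0` on `∂Ω`,
that is, `u = 𝓛⁻¹ g` for `𝓛 = -div(a ∇·)`. -/
def IsWeakSolution {d : ℕ} {Ω : Set (EuclideanSpace ℝ (Fin d))}
    (a : EuclideanSpace ℝ (Fin d) → Matrix (Fin d) (Fin d) ℝ)
    (g : EuclideanSpace ℝ (Fin d) → ℝ) (u : H10 Ω) : Prop :=
  ∀ v : H10 Ω, energyInner a v u = ∫ x in Ω, g x * val v x

/-- The measurement `∫_Ω ψ φ` of `ψ ∈ H¹₀(Ω)` by `φ`. -/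
def measurement {d : ℕ} {Ω : Set (EuclideanSpace ℝ (Fin d))}
    (φ : EuclideanSpace ℝ (Fin d) → ℝ) (ψ : H10 Ω) : ℝ :=
  ∫ x in Ω, φ x * val ψ x

open Classical in
/-- The constraints `∫_Ω φ_j ψ = δ_{i,j}` for all `j`. -/
def IsAdmissible {d : ℕ} {Ω : Set (EuclideanSpace ℝ (Fin d))} {ι : Type}
    (φ : ι → EuclideanSpace ℝ (Fin d) → ℝ) (i : ι) (ψ : H10 Ω) : Prop :=
  ∀ j, measurement (φ j) ψ = if i = j then 1 else 0

/-- `(ψ_i)` are the gamblets of the measurement functions `(φ_i)`: for each `i`, `ψ_i` minimizes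
`‖ψ‖_a` over all `ψ ∈ H¹₀(Ω)` with `∫_Ω φ_j ψ = δ_{i,j}` for all `j`. -/
def IsGamblets {d : ℕ} {Ω : Set (EuclideanSpace ℝ (Fin d))} {ι : Type}
    (a : EuclideanSpace ℝ (Fin d) → Matrix (Fin d) (Fin d) ℝ)
    (φ : ι → EuclideanSpace ℝ (Fin d) → ℝ) (ψ : ι → H10 Ω) : Prop :=
  ∀ i, IsAdmissible φ i (ψ i) ∧
    ∀ η : H10 Ω, IsAdmissible φ i η → energyNorm a (ψ i) ≤ energyNorm a η

/-- `∑_i ψ_i ∫_Ω u φ_i`. -/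
def recovery {d : ℕ} {Ω : Set (EuclideanSpace ℝ (Fin d))} {ι : Type} [Fintype ι]
    (φ : ι → EuclideanSpace ℝ (Fin d) → ℝ) (ψ : ι → H10 Ω) (u : H10 Ω) : H10 Ω :=
  ∑ i, measurement (φ i) u • ψ i

/-- The span of the functions `𝓛⁻¹ φ_i`. -/
def solutionSpan {d : ℕ} (Ω : Set (EuclideanSpace ℝ (Fin d))) {ι : Type}
    (a : EuclideanSpace ℝ (Fin d) → Matrix (Fin d) (Fin d) ℝ)
    (φ : ι → EuclideanSpace ℝ (Fin d) → ℝ) : Submodule ℝ (H10 Ω) :=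
  Submodule.span ℝ {w | ∃ i, IsWeakSolution a (φ i) w}

/-- The indicator functions of the sets `τ_i`. -/
def cellIndicator {d : ℕ} {ι : Type} (τ : ι → Set (EuclideanSpace ℝ (Fin d))) (i : ι) :
    EuclideanSpace ℝ (Fin d) → ℝ :=
  (τ i).indicator fun _ => 1

/-- `(τ_i)` is a partition of `Ω`, up to sets of measure zero, into convex subsets of `Ω` of
positive volume and of diameter at most `H`. -/
structure IsConvexPartition {d : ℕ} {ι : Type} (Ω : Set (EuclideanSpace ℝ (Fin d)))
    (τ : ι → Set (EuclideanSpace ℝ (Fin d))) (H : ℝ) : Prop where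
  subset : ∀ i, τ i ⊆ Ω
  disjoint : ∀ i j, i ≠ j → volume (τ i ∩ τ j) = 0
  cover : volume (Ω \ ⋃ i, τ i) = 0
  convex : ∀ i, Convex ℝ (τ i)
  volume_pos : ∀ i, 0 < volume (τ i)
  diam_le : ∀ i, Metric.diam (τ i) ≤ H

/-- An index tree of depth `q`: a finite set of `q`-tuples of positive integers, a tuple being
a list of length `q`. -/
def IsIndexTree (q : ℕ) (I : Finset (List ℕ)) : Prop :=
  ∀ i ∈ I, i.length = q ∧ ∀ n ∈ i, 1 ≤ n

/-- The set `I^(k)` of the truncations `i^(k) = (i_1, …, i_k)` of the elements of `I`. -/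
def level (I : Finset (List ℕ)) (k : ℕ) : Finset (List ℕ) :=
  I.image (List.take k)

/-- The set of the `j ∈ I^(k+1)` with `j^(k) = i`. -/
def children (I : Finset (List ℕ)) (k : ℕ) (i : List ℕ) : Finset (List ℕ) :=
  (level I (k + 1)).filter fun j => j.take k = i

/-- A hierarchy of nested partitions of `Ω`: for `1 ≤ k ≤ q` the sets `τ_i^(k)`, `i ∈ I^(k)`, are
a convex partition of mesh at most `H_k`, and for `k < q` each `τ_i^(k)` is, up to a set of
measure zero, the union of the `τ_j^(k+1)` over the children `j` of `i`. -/
structure IsNestedPartition {d : ℕ} (Ω : Set (EuclideanSpace ℝ (Fin d))) (q : ℕ)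
    (I : Finset (List ℕ)) (τ : (k : ℕ) → level I k → Set (EuclideanSpace ℝ (Fin d)))
    (H : ℕ → ℝ) : Prop where
  tree : IsIndexTree q I
  partition : ∀ k, 1 ≤ k → k ≤ q → IsConvexPartition Ω (τ k) (H k)
  nested : ∀ k, 1 ≤ k → k < q → ∀ i : level I k,
    τ k i =ᵐ[volume] ⋃ j : level I (k + 1), ⋃ _ : j.val ∈ children I k i, τ (k + 1) j

/-- The spaces `V^(k) = span {ψ_i^(k) : i ∈ I^(k)}` for `k ≤ q`, and `V^(q+1) = H¹₀(Ω)`. -/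
def gambletSpace {d : ℕ} {Ω : Set (EuclideanSpace ℝ (Fin d))} (q : ℕ) {I : Finset (List ℕ)}
    (ψ : (k : ℕ) → level I k → H10 Ω) (k : ℕ) : Submodule ℝ (H10 Ω) :=
  if k ≤ q then Submodule.span ℝ (Set.range (ψ k)) else ⊤

end Gamblet

end

noncomputable section

namespace Gamblet

open Set Filter Topology
open scoped ENNReal Pointwise

/-! The gamblets solve a constrained least-energy problem, and they form the basis of
$\operatorname{span}\{\mathcal L^{-1}\phi_i\}$ dual to the measurements: since $\langle v,\mathcal
L^{-1}\phi_i\rangle_a=\int\phi_i v$, a function with zero measurements is energy-orthogonal to that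
span, and Pythagoras gives existence, uniqueness and best approximation at once
(`form_eq_zero_of_mem_span`, `exists_isGamblets_iff_eq`, `sqrt_form_eq_iInf`). Nesting holds because
a coarse indicator is almost everywhere the sum of the indicators of its children, so $\mathcal
L^{-1}$ of it is a sum of fine solutions (`solutionSpan_le_of_refinement`).

For the error, $v=u-u^*$ has zero mean on every cell and $\|v\|_a^2=\langle v,u\rangle_a=\int
gv\le\|g\|\,\|v\|_{L^2}$. A Poincaré inequality on each cell with constant $2H/\pi$, together with
ellipticity, then yields the bound (`energyNorm_sub_recovery_le`).

The analytic core is this Poincaré inequality on convex sets with a constant free of the dimension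
(`poincare_of_integral_eq_zero`). If it failed, repeated bisections preserving both $\int f=0$ and
the violation would produce convex pieces shrinking to a line (`exists_needle_sequence`). On a thin
piece $f$ is nearly a function of one coordinate, so a weighted inequality on the line is needed,
the weight being the slice volume. By `prekopa_leindler` slice volumes are quasiconcave, hence
unimodal (`min_volume_slice_le`, `exists_mode`). On either side of the mode $c$, the layer-cake
formula reduces the weight to intervals with endpoint $c$, where Wirtinger's inequality for
functions vanishing at one end has constant $2H/\pi$ (`lintegral_wirtinger_of_unimodal`). Centring
at the value at $c$ instead of the mean is harmless, because $\int f=0$ on the piece. -/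

/-! ### Brunn–Minkowski on the line and the Prékopa–Leindler inequality -/

/-- One-dimensional Brunn–Minkowski inequality for compact sets. -/
theorem volume_add_volume_le_of_isCompact {A B C : Set ℝ} (hA : IsCompact A) (hB : IsCompact B)
    (hA0 : A.Nonempty) (hB0 : B.Nonempty) (hC : ∀ x ∈ A, ∀ y ∈ B, x + y ∈ C) :
    volume A + volume B ≤ volume C := by
  -- With $\alpha=\max A$ and $\beta=\min B$, the translates $A+\beta$ and $\alpha+B$ both lie in
  -- $C$ and meet only at $\alpha+\beta$.
  obtain ⟨α, hα, hα'⟩ := hA.exists_isGreatest hA0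
  obtain ⟨β, hβ, hβ'⟩ := hB.exists_isLeast hB0
  have h1 : volume ((fun x => x + β) '' A) = volume A := by
    rw [image_add_right, measure_preimage_add_right]
  have h2 : volume ((fun y => α + y) '' B) = volume B := by
    rw [image_add_left, measure_preimage_add]
  have hm : MeasurableSet ((fun y => α + y) '' B) :=
    (hB.image (by fun_prop)).measurableSet
  have hd : AEDisjoint volume ((fun x => x + β) '' A) ((fun y => α + y) '' B) := by
    refine measure_mono_null (t := {α + β}) ?_ (by simp)
    rintro z ⟨⟨x, hx, rfl⟩, ⟨y, hy, hxy⟩⟩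
    have := hα' hx
    have := hβ' hy
    simp only at hxy
    simp only [mem_singleton_iff]
    linarith
  rw [← h1, ← h2, ← measure_union₀ hm.nullMeasurableSet hd]
  refine measure_mono (union_subset ?_ ?_)
  · rintro _ ⟨x, hx, rfl⟩
    exact hC x hx β hβ
  · rintro _ ⟨y, hy, rfl⟩
    exact hC α hα y hy

/-- One-dimensional Brunn–Minkowski inequality. -/
theorem volume_add_volume_le {A B C : Set ℝ} (hA : MeasurableSet A) (hB : MeasurableSet B)
    (hA0 : A.Nonempty) (hB0 : B.Nonempty) (hC : ∀ x ∈ A, ∀ y ∈ B, x + y ∈ C) :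
    volume A + volume B ≤ volume C := by
  obtain ⟨x₀, hx₀⟩ := hA0
  obtain ⟨y₀, hy₀⟩ := hB0
  rw [hA.measure_eq_iSup_isCompact, hB.measure_eq_iSup_isCompact]
  simp only [iSup_and']
  refine ENNReal.biSup_add_biSup_le' ⟨∅, by simp⟩ ⟨∅, by simp⟩ ?_
  rintro K ⟨hKA, hK⟩ L ⟨hLB, hL⟩
  -- The compact sets from inner regularity may be empty; adjoining a point makes the compact case
  -- applicable.
  calc volume K + volume L ≤ volume (insert x₀ K) + volume (insert y₀ L) :=
        add_le_add (measure_mono (subset_insert _ _))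
          (measure_mono (subset_insert _ _))
    _ ≤ volume C := volume_add_volume_le_of_isCompact (hK.insert x₀) (hL.insert y₀)
        (insert_nonempty _ _) (insert_nonempty _ _) fun x hx y hy =>
          hC x (insert_subset hx₀ hKA hx) y (insert_subset hy₀ hLB hy)

/-- Weighted one-dimensional Brunn–Minkowski inequality. -/
theorem mul_volume_add_mul_volume_le {a b : ℝ} (ha : 0 < a) (hb : 0 < b)
    {A B C : Set ℝ} (hA : MeasurableSet A) (hB : MeasurableSet B)
    (hA0 : A.Nonempty) (hB0 : B.Nonempty) (hC : ∀ x ∈ A, ∀ y ∈ B, a * x + b * y ∈ C) :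
    ENNReal.ofReal a * volume A + ENNReal.ofReal b * volume B ≤ volume C := by
  have h := volume_add_volume_le (hA.const_smul₀ a) (hB.const_smul₀ b) (hA0.smul_set (a := a))
    (hB0.smul_set (a := b)) (C := C) (by
      rintro _ ⟨x, hx, rfl⟩ _ ⟨y, hy, rfl⟩
      exact hC x hx y hy)
  simpa [Measure.addHaar_smul, abs_of_pos ha, abs_of_pos hb] using h

theorem lintegral_ofReal_eq_lintegral_Ioo {f : ℝ → ℝ} (hf : Measurable f) (h0 : ∀ x, 0 ≤ f x)
    (h1 : ∀ x, f x ≤ 1) :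
    ∫⁻ x, ENNReal.ofReal (f x) = ∫⁻ s in Ioo (0 : ℝ) 1, volume {x | s < f x} := by
  rw [lintegral_eq_lintegral_meas_lt volume (ae_of_all _ h0) hf.aemeasurable,
    ← lintegral_indicator measurableSet_Ioi, ← lintegral_indicator measurableSet_Ioo]
  refine lintegral_congr fun s => ?_
  by_cases hs : s < 1
  · by_cases hs0 : 0 < s <;> simp [hs, hs0]
  · have : {x | s < f x} = ∅ := by
      ext x
      simpa using (h1 x).trans (not_lt.1 hs)
    by_cases hs0 : 0 < s <;> simp [hs, hs0, this]

/-- Layer-cake integration of Brunn–Minkowski over the heights $s\in(0,1)$. Requiring both suprema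
to be at least 1 keeps every superlevel set nonempty, without which Brunn–Minkowski fails. -/
theorem lintegral_add_le_of_superlevel {a b : ℝ} (ha : 0 < a) (hb : 0 < b) {f g h : ℝ → ℝ}
    (hf : Measurable f) (hg : Measurable g) (hh : Measurable h)
    (hf0 : ∀ x, 0 ≤ f x) (hg0 : ∀ x, 0 ≤ g x) (hh0 : ∀ x, 0 ≤ h x)
    (hf1 : ∀ x, f x ≤ 1) (hg1 : ∀ x, g x ≤ 1) (hh1 : ∀ x, h x ≤ 1)
    (hfs : ∀ s < 1, ∃ x, s < f x) (hgs : ∀ s < 1, ∃ x, s < g x)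
    (H : ∀ s ∈ Ioo (0 : ℝ) 1, ∀ x y, s < f x → s < g y → s < h (a * x + b * y)) :
    ENNReal.ofReal a * (∫⁻ x, ENNReal.ofReal (f x)) +
      ENNReal.ofReal b * (∫⁻ x, ENNReal.ofReal (g x)) ≤ ∫⁻ x, ENNReal.ofReal (h x) := by
  have hanti : ∀ f : ℝ → ℝ, Measurable fun s => volume {x | s < f x} := fun f =>
    Antitone.measurable fun s t hst => measure_mono fun x hx => lt_of_le_of_lt hst hx
  rw [lintegral_ofReal_eq_lintegral_Ioo hf hf0 hf1, lintegral_ofReal_eq_lintegral_Ioo hg hg0 hg1,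
    lintegral_ofReal_eq_lintegral_Ioo hh hh0 hh1, ← lintegral_const_mul _ (hanti f),
    ← lintegral_const_mul _ (hanti g), ← lintegral_add_left ((hanti f).const_mul _)]
  refine setLIntegral_mono (hanti h) fun s hs => ?_
  exact mul_volume_add_mul_volume_le ha hb (measurableSet_lt measurable_const hf)
    (measurableSet_lt measurable_const hg) (hfs s hs.2) (hgs s hs.2) fun x hx y hy => H s hs x y hx hy

theorem ennreal_geom_mean_le {a b : ℝ} (ha : 0 < a) (hb : 0 < b) (hab : a + b = 1) (p q : ℝ≥0∞) :
    p ^ a * q ^ b ≤ ENNReal.ofReal a * p + ENNReal.ofReal b * q := by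
  rcases eq_or_ne p ⊤ with rfl | hp
  · simp [ENNReal.mul_top, ha]
  rcases eq_or_ne q ⊤ with rfl | hq
  · simp [ENNReal.mul_top, hb]
  lift p to NNReal using hp
  lift q to NNReal using hq
  rw [← ENNReal.coe_rpow_of_nonneg _ ha.le, ← ENNReal.coe_rpow_of_nonneg _ hb.le]
  have := NNReal.geom_mean_le_arith_mean2_weighted a.toNNReal b.toNNReal p q
    (by rw [← Real.toNNReal_add ha.le hb.le, hab, Real.toNNReal_one])
  rw [Real.coe_toNNReal _ ha.le, Real.coe_toNNReal _ hb.le] at this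
  simp only [ENNReal.ofReal]
  exact_mod_cast this

/-- The Prékopa–Leindler inequality on the line for bounded functions. -/
theorem prekopa_leindler_real_of_bounded {a b : ℝ} (ha : 0 < a) (hb : 0 < b) (hab : a + b = 1)
    {f g h : ℝ → ℝ≥0∞} (hf : Measurable f) (hg : Measurable g) (hh : Measurable h)
    (hfb : ⨆ x, f x ≠ ⊤) (hgb : ⨆ x, g x ≠ ⊤)
    (H : ∀ x y, f x ^ a * g y ^ b ≤ h (a * x + b * y)) :
    (∫⁻ x, f x) ^ a * (∫⁻ x, g x) ^ b ≤ ∫⁻ x, h x := by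
  set F := ⨆ x, f x with hF
  set G := ⨆ x, g x with hG
  rcases eq_or_ne F 0 with hF0 | hF0
  · have : ∀ x, f x = 0 := fun x => by simpa [← hF, hF0] using le_iSup f x
    simp [this, ha]
  rcases eq_or_ne G 0 with hG0 | hG0
  · have : ∀ x, g x = 0 := fun x => by simpa [← hG, hG0] using le_iSup g x
    simp [this, hb]
  set c := F ^ a * G ^ b with hc
  have hFa0 : F ^ a ≠ 0 := by simp [hF0, hfb]
  have hGb0 : G ^ b ≠ 0 := by simp [hG0, hgb]
  have hFa : F ^ a ≠ ⊤ := ENNReal.rpow_ne_top_of_nonneg ha.le hfb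
  have hGb : G ^ b ≠ ⊤ := ENNReal.rpow_ne_top_of_nonneg hb.le hgb
  have hc0 : c ≠ 0 := mul_ne_zero hFa0 hGb0
  have hct : c ≠ ⊤ := ENNReal.mul_ne_top hFa hGb
  have hle : ∀ {f : ℝ → ℝ≥0∞} {F : ℝ≥0∞}, F = ⨆ x, f x → ∀ x, F⁻¹ * f x ≤ 1 := by
    rintro f F rfl x
    exact (mul_le_mul_right (le_iSup f x) _).trans (ENNReal.inv_mul_le_one _)
  have hlt : ∀ {s : ℝ} {p : ℝ≥0∞}, p ≠ ⊤ → ENNReal.ofReal s < p → s < p.toReal := by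
    intro s p hp h
    by_contra! hs
    exact h.not_ge ((ENNReal.le_ofReal_iff_toReal_le hp (ENNReal.toReal_nonneg.trans hs)).2 hs)
  have hsup : ∀ {f : ℝ → ℝ≥0∞} {F : ℝ≥0∞}, F = ⨆ x, f x → F ≠ 0 → F ≠ ⊤ → ∀ s < (1 : ℝ),
      ∃ x, s < (F⁻¹ * f x).toReal := by
    intro f F hF h0 ht s hs
    have h1 : ENNReal.ofReal s * F < ⨆ x, f x := by
      rw [← hF]
      calc ENNReal.ofReal s * F < 1 * F :=
            (ENNReal.mul_lt_mul_iff_left h0 ht).2 (by simpa using hs)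
        _ = F := one_mul _
    obtain ⟨x, hx⟩ := lt_iSup_iff.1 h1
    refine ⟨x, ?_⟩
    have h2 : ENNReal.ofReal s < F⁻¹ * f x := by
      rw [mul_comm, ← div_eq_mul_inv, ENNReal.lt_div_iff_mul_lt (Or.inl h0) (Or.inl ht)]
      exact hx
    exact hlt (ne_top_of_le_ne_top ENNReal.one_ne_top (hle hF x)) h2
  -- Dividing `f` and `g` by their suprema makes both suprema equal to 1, and `h` is scaled by the
  -- matching constant `c` and cut off at 1, which only lowers its integral. The resulting
  -- arithmetic-mean inequality is stronger than the geometric one.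
  have key := lintegral_add_le_of_superlevel ha hb
    (f := fun x => (F⁻¹ * f x).toReal) (g := fun x => (G⁻¹ * g x).toReal)
    (h := fun x => (min (c⁻¹ * h x) 1).toReal)
    (hf.const_mul _).ennreal_toReal (hg.const_mul _).ennreal_toReal
    ((hh.const_mul _).min measurable_const).ennreal_toReal
    (fun _ => ENNReal.toReal_nonneg) (fun _ => ENNReal.toReal_nonneg)
    (fun _ => ENNReal.toReal_nonneg)
    (fun x => ENNReal.toReal_le_of_le_ofReal zero_le_one (by simpa using hle hF x))
    (fun x => ENNReal.toReal_le_of_le_ofReal zero_le_one (by simpa using hle hG x))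
    (fun x => ENNReal.toReal_le_of_le_ofReal zero_le_one (by simp))
    (hsup hF hF0 hfb) (hsup hG hG0 hgb) ?_
  · have hne : ∀ x, min (c⁻¹ * h x) 1 ≠ ⊤ := fun x =>
      ne_top_of_le_ne_top ENNReal.one_ne_top (min_le_right _ _)
    simp only [ENNReal.ofReal_toReal (ne_top_of_le_ne_top ENNReal.one_ne_top (hle hF _)),
      ENNReal.ofReal_toReal (ne_top_of_le_ne_top ENNReal.one_ne_top (hle hG _)),
      ENNReal.ofReal_toReal (hne _)] at key
    rw [lintegral_const_mul _ hf, lintegral_const_mul _ hg] at key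
    have h1 := (ennreal_geom_mean_le ha hb hab _ _).trans (key.trans
      (lintegral_mono fun x => min_le_left _ _))
    rw [lintegral_const_mul _ hh, ENNReal.mul_rpow_of_nonneg _ _ ha.le,
      ENNReal.mul_rpow_of_nonneg _ _ hb.le, ENNReal.inv_rpow, ENNReal.inv_rpow,
      mul_mul_mul_comm, ← ENNReal.mul_inv (Or.inl hFa0) (Or.inl hFa)] at h1
    exact (ENNReal.mul_le_mul_iff_right (ENNReal.inv_ne_zero.2 hct)
      (ENNReal.inv_ne_top.2 hc0)).1 h1
  · intro s hs x y hx hy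
    have hx' := (ENNReal.ofReal_lt_iff_lt_toReal hs.1.le
      (ne_top_of_le_ne_top ENNReal.one_ne_top (hle hF x))).2 hx
    have hy' := (ENNReal.ofReal_lt_iff_lt_toReal hs.1.le
      (ne_top_of_le_ne_top ENNReal.one_ne_top (hle hG y))).2 hy
    refine hlt (ne_top_of_le_ne_top ENNReal.one_ne_top (min_le_right _ _)) (lt_min ?_ ?_)
    · have hs0 : ENNReal.ofReal s ≠ 0 := by simpa using hs.1
      calc ENNReal.ofReal s = ENNReal.ofReal s ^ a * ENNReal.ofReal s ^ b := by
            rw [← ENNReal.rpow_add _ _ hs0 ENNReal.ofReal_ne_top, hab, ENNReal.rpow_one]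
        _ < (F⁻¹ * f x) ^ a * (G⁻¹ * g y) ^ b :=
            ENNReal.mul_lt_mul (ENNReal.rpow_lt_rpow hx' ha) (ENNReal.rpow_lt_rpow hy' hb)
        _ = c⁻¹ * (f x ^ a * g y ^ b) := by
            rw [ENNReal.mul_rpow_of_nonneg _ _ ha.le,
              ENNReal.mul_rpow_of_nonneg _ _ hb.le, ENNReal.inv_rpow, ENNReal.inv_rpow,
              mul_mul_mul_comm, ← ENNReal.mul_inv (Or.inl hFa0) (Or.inl hFa)]
        _ ≤ c⁻¹ * h (a * x + b * y) := mul_le_mul_right (H x y) _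
    · simpa using hs.2

/-- The Prékopa–Leindler inequality on the line. -/
theorem prekopa_leindler_real {a b : ℝ} (ha : 0 < a) (hb : 0 < b) (hab : a + b = 1)
    {f g h : ℝ → ℝ≥0∞} (hf : Measurable f) (hg : Measurable g) (hh : Measurable h)
    (H : ∀ x y, f x ^ a * g y ^ b ≤ h (a * x + b * y)) :
    (∫⁻ x, f x) ^ a * (∫⁻ x, g x) ^ b ≤ ∫⁻ x, h x := by
  -- The bounded case applies to the truncations at height `N`; monotone convergence removes the
  -- truncation.
  have hlim : ∀ {f : ℝ → ℝ≥0∞}, Measurable f →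
      Tendsto (fun N : ℕ => ∫⁻ x, min (f x) N) atTop (𝓝 (∫⁻ x, f x)) := by
    intro f hf
    refine lintegral_tendsto_of_tendsto_of_monotone
      (fun N => (hf.min measurable_const).aemeasurable)
      (ae_of_all _ fun x M N hMN => min_le_min_left _ (by exact_mod_cast hMN))
      (ae_of_all _ fun x => ?_)
    have : Tendsto (fun N : ℕ => min (f x) (N : ℝ≥0∞)) atTop (𝓝 (min (f x) ⊤)) :=
      tendsto_const_nhds.min ENNReal.tendsto_nat_nhds_top
    simpa using this
  have hbd : ∀ {f : ℝ → ℝ≥0∞} {N : ℕ}, ⨆ x, min (f x) N ≠ ⊤ := fun {f N} =>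
    ne_top_of_le_ne_top (ENNReal.natCast_ne_top N) (iSup_le fun x => min_le_right _ _)
  have hN : ∀ N : ℕ, (∫⁻ x, min (f x) N) ^ a * (∫⁻ x, min (g x) N) ^ b ≤ ∫⁻ x, h x := fun N =>
    prekopa_leindler_real_of_bounded ha hb hab (hf.min measurable_const) (hg.min measurable_const)
      hh hbd hbd fun x y => le_trans (mul_le_mul' (ENNReal.rpow_le_rpow (min_le_left _ _) ha.le)
        (ENNReal.rpow_le_rpow (min_le_left _ _) hb.le)) (H x y)
  rcases eq_or_ne (∫⁻ x, f x) 0 with hf0 | hf0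
  · simp [hf0, ha]
  rcases eq_or_ne (∫⁻ x, g x) 0 with hg0 | hg0
  · simp [hg0, hb]
  refine le_of_tendsto' (ENNReal.Tendsto.mul ((hlim hf).ennrpow_const a) (Or.inl ?_)
    ((hlim hg).ennrpow_const b) (Or.inl ?_)) hN
  · simp [hf0, ha.le]
  · simp [hg0, hb.le]

/-- The Prékopa–Leindler inequality on `ℝⁿ`. -/
theorem prekopa_leindler {a b : ℝ} (ha : 0 < a) (hb : 0 < b) (hab : a + b = 1) (n : ℕ)
    {f g h : (Fin n → ℝ) → ℝ≥0∞} (hf : Measurable f) (hg : Measurable g) (hh : Measurable h)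
    (H : ∀ x y, f x ^ a * g y ^ b ≤ h (a • x + b • y)) :
    (∫⁻ x, f x) ^ a * (∫⁻ x, g x) ^ b ≤ ∫⁻ x, h x := by
  induction n with
  | zero =>
    have key : ∀ f : (Fin 0 → ℝ) → ℝ≥0∞, ∫⁻ x, f x = f 0 := by
      intro f
      rw [lintegral_unique, volume_pi, Measure.pi_of_empty]
      simp only [measure_univ, mul_one]
      congr 1
      exact Subsingleton.elim _ _
    simp only [key]
    simpa using H 0 0
  | succ n ih =>
    let e := (MeasurableEquiv.piFinSuccAbove (fun _ : Fin (n + 1) => ℝ) 0).symm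
    have he : MeasurePreserving e :=
      (volume_preserving_piFinSuccAbove (fun _ : Fin (n + 1) => ℝ) 0).symm _
    have key : ∀ f : (Fin (n + 1) → ℝ) → ℝ≥0∞, Measurable f →
        ∫⁻ x, f x = ∫⁻ t : ℝ, ∫⁻ y : Fin n → ℝ, f (e (t, y)) := by
      intro f hf
      rw [← he.lintegral_comp hf]
      exact lintegral_prod _ (hf.comp e.measurable).aemeasurable
    have hms : ∀ f : (Fin (n + 1) → ℝ) → ℝ≥0∞, Measurable f →
        Measurable fun t : ℝ => ∫⁻ y : Fin n → ℝ, f (e (t, y)) := fun f hf =>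
      (hf.comp e.measurable).lintegral_prod_right'
    rw [key f hf, key g hg, key h hh]
    -- The line case is applied to the marginals in the first coordinate; its hypothesis for them is
    -- the induction hypothesis on the slices.
    refine prekopa_leindler_real ha hb hab (hms f hf) (hms g hg) (hms h hh) fun s t => ?_
    refine ih (hf.comp (e.measurable.comp measurable_prodMk_left))
      (hg.comp (e.measurable.comp measurable_prodMk_left))
      (hh.comp (e.measurable.comp measurable_prodMk_left)) fun x y => ?_
    refine (H _ _).trans (le_of_eq ?_)
    congr 1
    ext i
    refine Fin.cases ?_ (fun i => ?_) i <;> simp [e, MeasurableEquiv.piFinSuccAbove]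

/-! ### Wirtinger's inequality on the line with a unimodal weight -/

theorem sq_mul_integral_sq_le_of_lt {G G' : ℝ → ℝ} (hG : ∀ t, HasDerivAt G (G' t) t)
    (hG' : Continuous G') {c l κ δ : ℝ} (hl : 0 ≤ l) (hκ : 0 ≤ κ) (hδ : 0 < δ)
    (h : κ * l + δ ≤ Real.pi / 2) :
    κ ^ 2 * ∫ t in c..(c + l), (G t - G c) ^ 2 ≤ ∫ t in c..(c + l), G' t ^ 2 := by
  have hGc : Continuous G := continuous_iff_continuousAt.2 fun t => (hG t).continuousAt
  -- The shift `δ` keeps the cotangent below finite at the left end, and `θ ≤ π/2` keeps it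
  -- nonnegative at the right end.
  set θ : ℝ → ℝ := fun t => κ * (t - c) + δ with hθ
  have hθ0 : ∀ t ∈ Icc c (c + l), 0 < θ t := fun t ht => by
    have := mul_nonneg hκ (sub_nonneg.2 ht.1)
    simp only [hθ]; linarith
  have hθ1 : ∀ t ∈ Icc c (c + l), θ t ≤ Real.pi / 2 := fun t ht => by
    have : κ * (t - c) ≤ κ * l := mul_le_mul_of_nonneg_left (by linarith [ht.2]) hκ
    simp only [hθ]; linarith
  have hsin : ∀ t ∈ Icc c (c + l), 0 < Real.sin (θ t) := fun t ht =>
    Real.sin_pos_of_pos_of_lt_pi (hθ0 t ht) (by linarith [hθ1 t ht, Real.pi_pos])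
  -- A Riccati multiplier: since $\cot'=-(1+\cot^2)$, completing the square gives $\Phi'\le
  -- G'^2-\kappa^2(G-G(c))^2$, while $\Phi(c)=0\le\Phi(c+l)$.
  set Φ : ℝ → ℝ := fun t => κ * (Real.cos (θ t) / Real.sin (θ t)) * (G t - G c) ^ 2 with hΦ
  have hθd : ∀ t, HasDerivAt θ κ t := fun t => by
    have := (((hasDerivAt_id t).sub_const c).const_mul κ).add_const δ
    rwa [mul_one] at this
  have hΦd : ∀ t ∈ Icc c (c + l), HasDerivAt Φ
      (κ * ((-Real.sin (θ t) * κ * Real.sin (θ t) - Real.cos (θ t) * (Real.cos (θ t) * κ)) /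
        Real.sin (θ t) ^ 2) * (G t - G c) ^ 2 +
        κ * (Real.cos (θ t) / Real.sin (θ t)) * (2 * (G t - G c) * G' t)) t := fun t ht => by
    have h1 := ((hθd t).cos.div (hθd t).sin (hsin t ht).ne').const_mul κ
    have h2 := ((hG t).sub_const (G c)).pow 2
    convert h1.mul h2 using 1
    all_goals first | rfl | simp
  have key := intervalIntegral.sub_le_integral_of_hasDeriv_right_of_le
    (φ := fun t => G' t ^ 2 - κ ^ 2 * (G t - G c) ^ 2) (by linarith : c ≤ c + l)
    (fun t ht => (hΦd t ht).continuousAt.continuousWithinAt)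
    (fun t ht => (hΦd t (Ioo_subset_Icc_self ht)).hasDerivWithinAt)
    (Continuous.integrableOn_Icc (by fun_prop)) (fun t ht => by
      have hs := (hsin t (Ioo_subset_Icc_self ht)).ne'
      have h1 := Real.sin_sq_add_cos_sq (θ t)
      have h2 : (-Real.sin (θ t) * κ * Real.sin (θ t) - Real.cos (θ t) * (Real.cos (θ t) * κ)) /
        Real.sin (θ t) ^ 2 = - κ * (1 + (Real.cos (θ t) / Real.sin (θ t)) ^ 2) := by
        field_simp
        ring
      rw [h2]
      nlinarith [sq_nonneg (G' t - κ * (Real.cos (θ t) / Real.sin (θ t)) * (G t - G c))])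
  rw [intervalIntegral.integral_sub (Continuous.intervalIntegrable (by fun_prop) _ _)
    (Continuous.intervalIntegrable (by fun_prop) _ _), intervalIntegral.integral_const_mul] at key
  have h0 : Φ c = 0 := by simp [hΦ]
  have h1 : 0 ≤ Φ (c + l) := by
    have hm : c + l ∈ Icc c (c + l) := ⟨by linarith, le_rfl⟩
    have := Real.cos_nonneg_of_neg_pi_div_two_le_of_le
      (by linarith [hθ0 _ hm, Real.pi_pos]) (hθ1 _ hm)
    have := (hsin _ hm).le
    positivity
  linarith

/-- Wirtinger's inequality on an interval of length at most `H` for functions vanishing at its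
left end. -/
theorem sq_mul_integral_sq_le {G G' : ℝ → ℝ} (hG : ∀ t, HasDerivAt G (G' t) t)
    (hG' : Continuous G') {c l H : ℝ} (hH : 0 < H) (hl : 0 ≤ l) (hlH : l ≤ H) :
    (Real.pi / (2 * H)) ^ 2 * ∫ t in c..(c + l), (G t - G c) ^ 2 ≤
      ∫ t in c..(c + l), G' t ^ 2 := by
  have hlim : Tendsto (fun κ : ℝ => κ ^ 2 * ∫ t in c..(c + l), (G t - G c) ^ 2)
      (𝓝[<] (Real.pi / (2 * H)))
      (𝓝 ((Real.pi / (2 * H)) ^ 2 * ∫ t in c..(c + l), (G t - G c) ^ 2)) :=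
    (Continuous.tendsto (by fun_prop) _).mono_left nhdsWithin_le_nhds
  have hpos : 0 < Real.pi / (2 * H) := by positivity
  refine le_of_tendsto hlim ?_
  filter_upwards [Ioo_mem_nhdsLT hpos] with κ hκ
  -- For $\kappa<\pi/(2H)$ there is room for a positive shift; the sharp constant is reached in the
  -- limit $\kappa\uparrow\pi/(2H)$.
  refine sq_mul_integral_sq_le_of_lt hG hG' hl hκ.1.le (δ := Real.pi / 2 - κ * H) ?_ ?_
  · have := (lt_div_iff₀ (by positivity)).1 hκ.2
    linarith
  · have := mul_le_mul_of_nonneg_left hlH hκ.1.le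
    linarith

/-- Up to a null set, such an `S` is the interval from `c` to its supremum, so the assumed interval
inequality applies directly. -/
theorem setLIntegral_le_of_intervals {S : Set ℝ} {c H : ℝ} (hS : S ⊆ Ioc c (c + H))
    (hS' : ∀ s t, c < s → s < t → t ∈ S → s ∈ S) {u w : ℝ → ℝ≥0∞}
    (h : ∀ l, 0 ≤ l → l ≤ H → ∫⁻ t in Ioo c (c + l), u t ≤ ∫⁻ t in Ioo c (c + l), w t) :
    ∫⁻ t in S, u t ≤ ∫⁻ t in S, w t := by
  rcases S.eq_empty_or_nonempty with rfl | ⟨t₀, ht₀⟩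
  · simp
  have hb : BddAbove S := ⟨c + H, fun t ht => (hS ht).2⟩
  have h1 : Ioo c (sSup S) ⊆ S := fun s hs => by
    obtain ⟨t, ht, hst⟩ := exists_lt_of_lt_csSup ⟨t₀, ht₀⟩ hs.2
    exact hS' s t hs.1 hst ht
  have h2 : S ⊆ Ioc c (sSup S) := fun t ht => ⟨(hS ht).1, le_csSup hb ht⟩
  have hae : S =ᵐ[volume] Ioo c (sSup S) :=
    (LE.le.eventuallyLE h2).trans Ioo_ae_eq_Ioc.symm.le |>.antisymm
      (LE.le.eventuallyLE h1)
  rw [setLIntegral_congr hae, setLIntegral_congr hae]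
  have := h (sSup S - c) (by linarith [(hS ht₀).1, le_csSup hb ht₀])
    (by linarith [csSup_le ⟨t₀, ht₀⟩ fun t ht => (hS ht).2])
  simpa using this

/-- By the layer-cake formula, an antitone weight is a superposition of indicators of intervals
starting at `c`, so only those intervals need testing. -/
theorem setLIntegral_mul_le_of_antitoneOn {A : ℝ → ℝ} (hA : Measurable A) (hA0 : ∀ t, 0 ≤ A t)
    {c H : ℝ} (hAc : AntitoneOn A (Ioi c)) (hAH : ∀ t, A t ≠ 0 → t ≤ c + H) {u w : ℝ → ℝ≥0∞}
    (hu : Measurable u) (hw : Measurable w)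
    (h : ∀ l, 0 ≤ l → l ≤ H → ∫⁻ t in Ioo c (c + l), u t ≤ ∫⁻ t in Ioo c (c + l), w t) :
    ∫⁻ t in Ioi c, ENNReal.ofReal (A t) * u t ≤ ∫⁻ t in Ioi c, ENNReal.ofReal (A t) * w t := by
  have key : ∀ u : ℝ → ℝ≥0∞, Measurable u →
      ∫⁻ t in Ioi c, ENNReal.ofReal (A t) * u t =
        ∫⁻ s in Ioi (0 : ℝ), ∫⁻ t in {t | s < A t} ∩ Ioi c, u t := by
    intro u hu
    have h1 := lintegral_eq_lintegral_meas_lt ((volume.restrict (Ioi c)).withDensity u)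
      (ae_of_all _ hA0) hA.aemeasurable
    rw [lintegral_withDensity_eq_lintegral_mul _ hu (by fun_prop)] at h1
    have h2 : ∀ s, ((volume.restrict (Ioi c)).withDensity u) {t | s < A t} =
        ∫⁻ t in {t | s < A t} ∩ Ioi c, u t := fun s => by
      have hm : MeasurableSet {t | s < A t} := measurableSet_lt measurable_const hA
      rw [withDensity_apply _ hm, Measure.restrict_restrict hm]
    simp only [h2] at h1
    rw [← h1]
    simp [mul_comm]
  rw [key u hu, key w hw]
  refine setLIntegral_mono' measurableSet_Ioi fun s hs => ?_
  have hs : 0 < s := hs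
  refine setLIntegral_le_of_intervals (fun t ht => ⟨ht.2, hAH t (hs.trans ht.1).ne'⟩) ?_ h
  exact fun r t hr hrt ht => ⟨lt_of_lt_of_le ht.1 (hAc hr ht.2 hrt.le), hr⟩

theorem setLIntegral_Ioi_wirtinger {A : ℝ → ℝ} (hA : Measurable A) (hA0 : ∀ t, 0 ≤ A t)
    {c H : ℝ} (hH : 0 < H) (hAc : AntitoneOn A (Ioi c)) (hAH : ∀ t, A t ≠ 0 → t ≤ c + H)
    {G G' : ℝ → ℝ} (hG : ∀ t, HasDerivAt G (G' t) t) (hG' : Continuous G') :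
    ∫⁻ t in Ioi c, ENNReal.ofReal (A t) *
        ENNReal.ofReal ((Real.pi / (2 * H)) ^ 2 * (G t - G c) ^ 2) ≤
      ∫⁻ t in Ioi c, ENNReal.ofReal (A t) * ENNReal.ofReal (G' t ^ 2) := by
  have hGc : Continuous G := continuous_iff_continuousAt.2 fun t => (hG t).continuousAt
  refine setLIntegral_mul_le_of_antitoneOn hA hA0 hAc hAH (by fun_prop) (by fun_prop)
    fun l hl hlH => ?_
  have key : ∀ u : ℝ → ℝ, Continuous u → (∀ t, 0 ≤ u t) →
      ∫⁻ t in Ioo c (c + l), ENNReal.ofReal (u t) = ENNReal.ofReal (∫ t in c..(c + l), u t) := by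
    intro u hu hu0
    rw [intervalIntegral.integral_of_le (by linarith), setLIntegral_congr Ioo_ae_eq_Ioc,
      ofReal_integral_eq_lintegral_ofReal (hu.integrableOn_Icc.mono_set Ioc_subset_Icc_self) (ae_of_all _ hu0)]
  rw [key _ (by fun_prop) (fun t => by positivity), key _ (by fun_prop) (fun t => by positivity),
    intervalIntegral.integral_const_mul]
  exact ENNReal.ofReal_le_ofReal (sq_mul_integral_sq_le hG hG' hH hl hlH)

/-- Wirtinger's inequality for a unimodal weight. -/
theorem lintegral_wirtinger_of_unimodal {A : ℝ → ℝ} (hA : Measurable A) (hA0 : ∀ t, 0 ≤ A t)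
    {c H : ℝ} (hH : 0 < H) (hAc : MonotoneOn A (Iio c)) (hAc' : AntitoneOn A (Ioi c))
    (hAH : ∀ t, A t ≠ 0 → |t - c| ≤ H)
    {G G' : ℝ → ℝ} (hG : ∀ t, HasDerivAt G (G' t) t) (hG' : Continuous G') :
    ∫⁻ t, ENNReal.ofReal (A t) * ENNReal.ofReal ((Real.pi / (2 * H)) ^ 2 * (G t - G c) ^ 2) ≤
      ∫⁻ t, ENNReal.ofReal (A t) * ENNReal.ofReal (G' t ^ 2) := by
  have h1 := setLIntegral_Ioi_wirtinger hA hA0 hH hAc'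
    (fun t ht => by linarith [(abs_le.1 (hAH t ht)).2]) hG hG'
  -- The left side of the mode is the right side after the reflection `t ↦ -t`.
  have h2 := setLIntegral_Ioi_wirtinger (A := fun t => A (-t)) (c := -c) (hA.comp measurable_neg)
    (fun t => hA0 _) hH
    (fun s hs t ht hst => hAc (show -t < c by linarith [show -c < t from ht])
      (show -s < c by linarith [show -c < s from hs]) (neg_le_neg hst))
    (fun t ht => by linarith [(abs_le.1 (hAH _ ht)).1])
    (G := fun t => G (-t)) (G' := fun t => -G' (-t))
    (fun t => by
      have := (hG (-t)).comp t (hasDerivAt_neg t)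
      rwa [mul_neg_one] at this) (by fun_prop)
  have h3 : ∀ u : ℝ → ℝ≥0∞, ∫⁻ t in Ioi (-c), u (-t) = ∫⁻ t in Iio c, u t := fun u => by
    have := (Measure.measurePreserving_neg (volume : Measure ℝ)).setLIntegral_comp_preimage_emb
      (MeasurableEquiv.neg ℝ).measurableEmbedding u (Iio c)
    simpa using this
  simp only [neg_neg, neg_sq] at h2
  rw [h3 fun t => ENNReal.ofReal (A t) *
      ENNReal.ofReal ((Real.pi / (2 * H)) ^ 2 * (G t - G c) ^ 2),
    h3 fun t => ENNReal.ofReal (A t) * ENNReal.ofReal (G' t ^ 2)] at h2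
  have h4 : ∀ u : ℝ → ℝ≥0∞, ∫⁻ t, u t = (∫⁻ t in Iio c, u t) + ∫⁻ t in Ioi c, u t := fun u => by
    rw [← lintegral_add_compl u (measurableSet_Iio (a := c)), compl_Iio,
      setLIntegral_congr Ioi_ae_eq_Ici]
  rw [h4, h4 fun t => ENNReal.ofReal (A t) * ENNReal.ofReal (G' t ^ 2)]
  exact add_le_add h2 h1

/-! ### Slices of convex bodies and functions of one coordinate -/

/-- A quasiconcave function supported in an interval is unimodal, with mode in the interval. -/
theorem exists_mode {A : ℝ → ℝ} (hA0 : ∀ t, 0 ≤ A t)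
    (hq : ∀ x y z, x < z → z < y → min (A x) (A y) ≤ A z) {α β : ℝ}
    (hs : ∀ t, A t ≠ 0 → t ∈ Icc α β) (hne : ∃ t, A t ≠ 0) :
    ∃ c ∈ Icc α β, MonotoneOn A (Iio c) ∧ AntitoneOn A (Ioi c) := by
  obtain ⟨t₀, ht₀⟩ := hne
  have hpos : 0 < A t₀ := lt_of_le_of_ne (hA0 t₀) (Ne.symm ht₀)
  -- `L` holds the points at which `A` is exceeded further to the right. Quasiconcavity makes it a
  -- lower set on which `A` increases, and beyond it `A` cannot increase, so its supremum is a mode.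
  set L : Set ℝ := {t | ∃ t', t < t' ∧ A t < A t'} with hL
  have hLs : ∀ t, t < α → t ∈ L := fun t ht => by
    refine ⟨t₀, ht.trans_le (hs t₀ ht₀).1, ?_⟩
    have : A t = 0 := by
      by_contra h
      exact absurd (hs t h).1 (not_le.2 ht)
    rwa [this]
  have hLb : ∀ t ∈ L, t ≤ β := by
    rintro t ⟨t', h1, h2⟩
    exact h1.le.trans (hs t' ((hA0 t).trans_lt h2).ne').2
  have hLne : L.Nonempty := ⟨α - 1, hLs _ (by linarith)⟩
  have hLbd : BddAbove L := ⟨β, hLb⟩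
  have hmono : ∀ s t, s < t → t ∈ L → A s ≤ A t := by
    rintro s t hst ⟨t', h1, h2⟩
    exact (min_le_iff.1 (hq s t' t hst h1)).resolve_right (not_le.2 h2)
  have hlow : ∀ s t, s < t → t ∈ L → s ∈ L := by
    rintro s t hst ⟨t', h1, h2⟩
    exact ⟨t', hst.trans h1, (hmono s t hst ⟨t', h1, h2⟩).trans_lt h2⟩
  refine ⟨sSup L, ⟨?_, csSup_le hLne hLb⟩, ?_, ?_⟩
  · refine le_of_forall_lt fun t ht => ?_
    obtain ⟨t', h1, h2⟩ := exists_between ht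
    exact h1.trans_le (le_csSup hLbd (hLs t' h2))
  · intro s _ t ht hst
    obtain ⟨t', h1, h2⟩ := exists_lt_of_lt_csSup hLne ht
    rcases hst.eq_or_lt with rfl | hst
    · exact le_rfl
    · exact hmono s t hst (hlow t t' h2 h1)
  · intro s hs' t _ hst
    rcases hst.eq_or_lt with rfl | hst
    · exact le_rfl
    · by_contra! h
      exact absurd (le_csSup hLbd (show s ∈ L from ⟨t, hst, h⟩)) (not_le.2 hs')

/-- The volume of the slices of a convex set is quasiconcave. -/
theorem min_volume_slice_le {n : ℕ} {K : Set (ℝ × (Fin n → ℝ))} (hK : Convex ℝ K)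
    (hKm : MeasurableSet K) {x y z : ℝ} (hxz : x < z) (hzy : z < y) :
    min (volume (Prod.mk x ⁻¹' K)) (volume (Prod.mk y ⁻¹' K)) ≤ volume (Prod.mk z ⁻¹' K) := by
  have hxy : 0 < y - x := by linarith
  set a := (y - z) / (y - x) with ha
  set b := (z - x) / (y - x) with hb
  have ha0 : 0 < a := div_pos (by linarith) hxy
  have hb0 : 0 < b := div_pos (by linarith) hxy
  have hab : a + b = 1 := by rw [ha, hb]; field_simp; ring
  have hz : a * x + b * y = z := by rw [ha, hb]; field_simp; ring
  have hm : ∀ t : ℝ, MeasurableSet (Prod.mk t ⁻¹' K : Set (Fin n → ℝ)) :=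
    fun t => measurable_prodMk_left hKm
  have h := prekopa_leindler ha0 hb0 hab n (f := (Prod.mk x ⁻¹' K).indicator 1)
    (g := (Prod.mk y ⁻¹' K).indicator 1) (h := (Prod.mk z ⁻¹' K).indicator 1)
    (measurable_const.indicator (hm x)) (measurable_const.indicator (hm y))
    (measurable_const.indicator (hm z)) (fun u v => by
      by_cases hu : (x, u) ∈ K
      · by_cases hv : (y, v) ∈ K
        · have := hK hu hv ha0.le hb0.le hab
          simp only [Prod.smul_mk, Prod.mk_add_mk, smul_eq_mul, hz] at this
          simp [indicator, hu, hv, this]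
        · simp [indicator, hv, hb0]
      · simp [indicator, hu, ha0])
  rw [lintegral_indicator_one (hm x), lintegral_indicator_one (hm y),
    lintegral_indicator_one (hm z)] at h
  refine le_trans ?_ h
  -- Prékopa–Leindler bounds the middle slice below by a weighted geometric mean, which dominates
  -- the minimum.
  set m := min (volume (Prod.mk x ⁻¹' K)) (volume (Prod.mk y ⁻¹' K))
  calc m = m ^ a * m ^ b := by
        rw [← ENNReal.rpow_add_of_nonneg _ _ ha0.le hb0.le, hab, ENNReal.rpow_one]
    _ ≤ _ := mul_le_mul' (ENNReal.rpow_le_rpow (min_le_left _ _) ha0.le)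
        (ENNReal.rpow_le_rpow (min_le_right _ _) hb0.le)

theorem lintegral_wirtinger_of_convex_prod {n : ℕ} {K : Set (ℝ × (Fin n → ℝ))} (hK : Convex ℝ K)
    (hKm : MeasurableSet K) (hKb : Bornology.IsBounded K) (hK0 : volume K ≠ 0) {H : ℝ} (hH : 0 < H)
    (hKH : ∀ x ∈ K, ∀ y ∈ K, |x.1 - y.1| ≤ H) {G G' : ℝ → ℝ}
    (hG : ∀ t, HasDerivAt G (G' t) t) (hG' : Continuous G') :
    ∃ c, ∫⁻ x in K, ENNReal.ofReal ((Real.pi / (2 * H)) ^ 2 * (G x.1 - G c) ^ 2) ≤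
      ∫⁻ x in K, ENNReal.ofReal (G' x.1 ^ 2) := by
  have hGc : Continuous G := continuous_iff_continuousAt.2 fun t => (hG t).continuousAt
  set A : ℝ → ℝ := fun t => (volume (Prod.mk t ⁻¹' K)).toReal with hA
  have hfin : ∀ t, volume (Prod.mk t ⁻¹' K) ≠ ⊤ := fun t => by
    have h1 : Bornology.IsBounded (Prod.snd '' K) := hKb.image_snd
    exact (measure_mono (t := Prod.snd '' K) fun y hy => ⟨(t, y), hy, rfl⟩).trans_lt
      h1.measure_lt_top |>.ne
  have hAm : Measurable A := (measurable_measure_prodMk_left hKm).ennreal_toReal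
  have hofReal : ∀ t, ENNReal.ofReal (A t) = volume (Prod.mk t ⁻¹' K) := fun t =>
    ENNReal.ofReal_toReal (hfin t)
  have hprod : ∀ u : ℝ → ℝ≥0∞, Measurable u →
      ∫⁻ x in K, u x.1 = ∫⁻ t, ENNReal.ofReal (A t) * u t := fun u hu => by
    rw [← lintegral_indicator hKm, Measure.volume_eq_prod, lintegral_prod _ (by
      exact ((hu.comp measurable_fst).indicator hKm).aemeasurable)]
    refine lintegral_congr fun t => ?_
    rw [hofReal, mul_comm, ← setLIntegral_const, ← lintegral_indicator (measurable_prodMk_left hKm)]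
    rfl
  have hne : ∃ t, A t ≠ 0 := by
    by_contra! h
    have := hprod 1 measurable_const
    simp [h] at this
    exact hK0 this
  have hKne : K.Nonempty := nonempty_of_measure_ne_zero hK0
  have hPb : Bornology.IsBounded (Prod.fst '' K) := hKb.image_fst
  have hPne : (Prod.fst '' K).Nonempty := hKne.image _
  obtain ⟨c, hc, h1, h2⟩ := exists_mode (A := A) (fun t => ENNReal.toReal_nonneg)
    (fun x y z hxz hzy => by
      have := min_volume_slice_le hK hKm hxz hzy
      rw [← hofReal, ← hofReal, ← hofReal, ← ENNReal.ofReal_min] at this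
      exact (ENNReal.ofReal_le_ofReal_iff ENNReal.toReal_nonneg).1 this)
    -- The mode lies in the hull of the projection of `K`, whose length is at most `H`; this gives
    -- $|t-c|\le H$ wherever the slice volume is nonzero.
    (α := sInf (Prod.fst '' K)) (β := sSup (Prod.fst '' K))
    (fun t ht => by
      have : (Prod.mk t ⁻¹' K).Nonempty := by
        refine nonempty_of_measure_ne_zero (μ := volume) fun h => ht (by simp [hA, h])
      obtain ⟨y, hy⟩ := this
      have hm : t ∈ Prod.fst '' K := ⟨(t, y), hy, rfl⟩
      exact ⟨csInf_le hPb.bddBelow hm, le_csSup hPb.bddAbove hm⟩) hne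
  refine ⟨c, ?_⟩
  rw [hprod (fun t => ENNReal.ofReal ((Real.pi / (2 * H)) ^ 2 * (G t - G c) ^ 2)) (by fun_prop),
    hprod (fun t => ENNReal.ofReal (G' t ^ 2)) (by fun_prop)]
  refine lintegral_wirtinger_of_unimodal hAm (fun t => ENNReal.toReal_nonneg) hH h1 h2
    (fun t ht => ?_) hG hG'
  have : (Prod.mk t ⁻¹' K).Nonempty := by
    refine nonempty_of_measure_ne_zero (μ := volume) fun h => ht (by simp [hA, h])
  obtain ⟨y, hy⟩ := this
  rw [abs_le]
  constructor
  · have : sSup (Prod.fst '' K) ≤ t + H := csSup_le hPne (by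
      rintro _ ⟨z, hz, rfl⟩
      linarith [(abs_le.1 (hKH z hz _ hy)).2])
    linarith [hc.2]
  · have : t - H ≤ sInf (Prod.fst '' K) := le_csInf hPne (by
      rintro _ ⟨z, hz, rfl⟩
      linarith [(abs_le.1 (hKH _ hy z hz)).2])
    linarith [hc.1]

/-- Wirtinger's inequality on a convex body for functions of one coordinate. -/
theorem lintegral_wirtinger_of_convex {d : ℕ} {K : Set (EuclideanSpace ℝ (Fin d))}
    (hK : Convex ℝ K) (hKm : MeasurableSet K) (hKb : Bornology.IsBounded K) (hK0 : volume K ≠ 0)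
    {H : ℝ} (hH : 0 < H) (hKH : ∀ x ∈ K, ∀ y ∈ K, dist x y ≤ H)
    {e : EuclideanSpace ℝ (Fin d)} (he : ‖e‖ = 1) {G G' : ℝ → ℝ}
    (hG : ∀ t, HasDerivAt G (G' t) t) (hG' : Continuous G') :
    ∃ c, ∫⁻ x in K, ENNReal.ofReal ((Real.pi / (2 * H)) ^ 2 * (G (inner ℝ e x) - G c) ^ 2) ≤
      ∫⁻ x in K, ENNReal.ofReal (G' (inner ℝ e x) ^ 2) := by
  obtain _ | n := d
  · simp [Subsingleton.elim e 0] at he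
  have hon : Orthonormal ℝ (({0} : Set (Fin (n + 1))).domRestrict fun _ => e) := by
    rw [orthonormal_iff_ite]
    rintro ⟨i, hi⟩ ⟨j, hj⟩
    obtain rfl : i = 0 := hi
    obtain rfl : j = 0 := hj
    simpa [Set.domRestrict] using Or.inl he
  obtain ⟨b, hb⟩ := hon.exists_orthonormalBasis_extension_of_card_eq (by simp)
  have hb0 : b 0 = e := hb 0 rfl
  -- Orthonormal coordinates with `e` as first basis vector turn the inner product with `e` into the
  -- first coordinate and preserve volume.
  let Φ : EuclideanSpace ℝ (Fin (n + 1)) ≃ᵐ ℝ × (Fin n → ℝ) :=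
    (b.measurableEquiv.trans (MeasurableEquiv.toLp 2 (Fin (n + 1) → ℝ)).symm).trans
      (MeasurableEquiv.piFinSuccAbove (fun _ => ℝ) 0)
  have hΦ : MeasurePreserving Φ :=
    (volume_preserving_piFinSuccAbove (fun _ : Fin (n + 1) => ℝ) 0).comp
      ((EuclideanSpace.volume_preserving_symm_measurableEquiv_toLp _).comp
        b.measurePreserving_measurableEquiv)
  have hΦ1 : ∀ x, (Φ x).1 = inner ℝ e x := fun x => by
    rw [← hb0, ← b.repr_apply_apply]
    rfl
  have hadd : ∀ x y, Φ (x + y) = Φ x + Φ y := fun x y => by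
    have h : ∀ z, Φ z = (b.repr z 0, fun i => b.repr z (Fin.succ i)) := fun z => rfl
    simp only [h, map_add]
    rfl
  have hsmul : ∀ (r : ℝ) x, Φ (r • x) = r • Φ x := fun r x => by
    have h : ∀ z, Φ z = (b.repr z 0, fun i => b.repr z (Fin.succ i)) := fun z => rfl
    simp only [h, map_smul]
    rfl
  let ΦL : EuclideanSpace ℝ (Fin (n + 1)) →ₗ[ℝ] ℝ × (Fin n → ℝ) :=
    { toFun := Φ, map_add' := hadd, map_smul' := hsmul }
  have hpre : Φ ⁻¹' (Φ '' K) = K := preimage_image_eq K Φ.injective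
  have hm : MeasurableSet (Φ '' K) := Φ.measurableSet_image.2 hKm
  have hcomp : ∀ u : ℝ → ℝ≥0∞, ∫⁻ x in Φ '' K, u x.1 = ∫⁻ x in K, u (inner ℝ e x) := fun u => by
    rw [← hΦ.setLIntegral_comp_preimage_emb Φ.measurableEmbedding (fun x => u x.1), hpre]
    simp only [hΦ1]
  obtain ⟨c, hc⟩ := lintegral_wirtinger_of_convex_prod (K := Φ '' K) (hK.linear_image ΦL) hm
    (ΦL.toContinuousLinearMap.lipschitz.isBounded_image hKb)
    (by rwa [← hΦ.measure_preimage hm.nullMeasurableSet, hpre]) hH (by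
      rintro _ ⟨x, hx, rfl⟩ _ ⟨y, hy, rfl⟩
      rw [hΦ1, hΦ1, ← inner_sub_right]
      refine (abs_real_inner_le_norm _ _).trans ?_
      rw [he, one_mul, ← dist_eq_norm]
      exact hKH x hx y hy) hG hG'
  refine ⟨c, ?_⟩
  rwa [hcomp fun t => ENNReal.ofReal ((Real.pi / (2 * H)) ^ 2 * (G t - G c) ^ 2),
    hcomp fun t => ENNReal.ofReal (G' t ^ 2)] at hc

/-! ### Needle decomposition -/

theorem volume_hyperplane_eq_zero {d : ℕ} (L : EuclideanSpace ℝ (Fin d) →ₗ[ℝ] ℝ) (hL : L ≠ 0)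
    (c : ℝ) : volume {x | L x = c} = 0 := by
  rcases Set.eq_empty_or_nonempty {x | L x = c} with h | ⟨x₀, hx₀⟩
  · simp [h]
  have h1 : {x | L x = c} = (fun x => -x₀ + x) ⁻¹' (LinearMap.ker L : Set _) := by
    ext x
    have hx₀ : L x₀ = c := hx₀
    simp only [mem_ofPred_eq, mem_preimage, SetLike.mem_coe, LinearMap.mem_ker, map_add, map_neg,
      hx₀]
    constructor <;> intro h <;> linarith
  rw [h1, measure_preimage_add]
  exact Measure.addHaar_submodule _ _ (by rwa [Ne, LinearMap.ker_eq_top])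

/-- The affine function `α (x_i - r) + β (x_j - s)`. -/
def coordAffine {d : ℕ} (i j : Fin d) (r s α β : ℝ) (x : EuclideanSpace ℝ (Fin d)) : ℝ :=
  α * (x i - r) + β * (x j - s)

theorem continuous_coordAffine {d : ℕ} (i j : Fin d) (r s α β : ℝ) :
    Continuous (coordAffine i j r s α β) := by
  unfold coordAffine
  fun_prop

theorem volume_coordAffine_eq_zero {d : ℕ} {i j : Fin d} (hij : i ≠ j) (r s : ℝ) {α β : ℝ}
    (h : α ≠ 0 ∨ β ≠ 0) : volume {x | coordAffine i j r s α β x = 0} = 0 := by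
  let L : EuclideanSpace ℝ (Fin d) →ₗ[ℝ] ℝ :=
    α • (EuclideanSpace.proj i : EuclideanSpace ℝ (Fin d) →L[ℝ] ℝ).toLinearMap +
      β • (EuclideanSpace.proj j : EuclideanSpace ℝ (Fin d) →L[ℝ] ℝ).toLinearMap
  have hLx : ∀ x, L x = α * x i + β * x j := fun x => by simp [L]
  have hL : L ≠ 0 := by
    intro h0
    rcases h with h | h
    · have := hLx (EuclideanSpace.single i 1)
      simp [h0, hij.symm] at this
      exact h this.symm
    · have := hLx (EuclideanSpace.single j 1)
      simp [h0, hij] at this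
      exact h this.symm
  rw [← volume_hyperplane_eq_zero L hL (α * r + β * s)]
  congr 1
  ext x
  simp only [coordAffine, mem_ofPred_eq, hLx]
  constructor <;> intro h <;> linarith

theorem convex_coordAffine_pos {d : ℕ} (i j : Fin d) (r s α β : ℝ) :
    Convex ℝ {x | 0 < coordAffine i j r s α β x} := by
  intro x hx y hy a b ha hb hab
  simp only [coordAffine, mem_ofPred_eq, PiLp.add_apply, PiLp.smul_apply, smul_eq_mul] at *
  have : α * (a * x i + b * y i - r) + β * (a * x j + b * y j - s) =
      a * (α * (x i - r) + β * (x j - s)) + b * (α * (y i - r) + β * (y j - s)) := by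
    linear_combination (α * r + β * s) * hab
  rw [this]
  rcases ha.eq_or_lt with rfl | ha
  · obtain rfl : b = 1 := by linarith
    linarith
  · have := mul_pos ha hx
    have := mul_nonneg hb hy.le
    linarith

/-- A bounded convex open set can be cut by a hyperplane parallel to a given coordinate subspace of
codimension two into two pieces over which the integral of `f` vanishes. -/
theorem exists_bisection {d : ℕ} {K : Set (EuclideanSpace ℝ (Fin d))} (hKo : IsOpen K)
    (hKc : Convex ℝ K) {f g : EuclideanSpace ℝ (Fin d) → ℝ}
    (hf : IntegrableOn f K) (hg : IntegrableOn g K) (hf0 : ∫ x in K, f x = 0)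
    (hg0 : 0 < ∫ x in K, g x) {i j : Fin d} (hij : i ≠ j) (r s : ℝ) :
    ∃ K' ⊆ K, IsOpen K' ∧ Convex ℝ K' ∧ ∫ x in K', f x = 0 ∧ 0 < ∫ x in K', g x ∧
      ∃ α β : ℝ, (α ≠ 0 ∨ β ≠ 0) ∧ ∀ x ∈ K', 0 ≤ coordAffine i j r s α β x := by
  set h : ℝ → EuclideanSpace ℝ (Fin d) → ℝ := fun θ => coordAffine i j r s (Real.cos θ) (Real.sin θ)
    with hh
  have hcs : ∀ θ : ℝ, Real.cos θ ≠ 0 ∨ Real.sin θ ≠ 0 := fun θ => by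
    by_contra! hθ
    have := Real.sin_sq_add_cos_sq θ
    simp [hθ.1, hθ.2] at this
  have hhθ : ∀ x, Continuous fun θ => h θ x := fun x => by
    simp only [hh, coordAffine]; fun_prop
  have hopen : ∀ θ, IsOpen {x | 0 < h θ x} := fun θ =>
    isOpen_lt continuous_const (continuous_coordAffine _ _ _ _ _ _)
  have hneg : ∀ θ x, h (θ + Real.pi) x = - h θ x := fun θ x => by
    simp only [hh, coordAffine, Real.cos_add_pi, Real.sin_add_pi]; ring
  have hnull : ∀ θ, ∀ᵐ x ∂(volume : Measure (EuclideanSpace ℝ (Fin d))), h θ x ≠ 0 := fun θ => by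
    rw [ae_iff]
    simpa using volume_coordAffine_eq_zero hij r s (hcs θ)
  have hsplit : ∀ (u : EuclideanSpace ℝ (Fin d) → ℝ), IntegrableOn u K → ∀ θ,
      (∫ x in K ∩ {x | 0 < h θ x}, u x) + ∫ x in K ∩ {x | 0 < h (θ + Real.pi) x}, u x =
        ∫ x in K, u x := by
    intro u hu θ
    have hd : Disjoint (K ∩ {x | 0 < h θ x}) (K ∩ {x | 0 < h (θ + Real.pi) x}) := by
      rw [Set.disjoint_left]
      rintro x ⟨_, h1⟩ ⟨_, h2⟩
      simp only [mem_ofPred_eq, hneg] at h1 h2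
      linarith
    rw [← setIntegral_union hd (hKo.inter (hopen _)).measurableSet
      (hu.mono_set inter_subset_left) (hu.mono_set inter_subset_left)]
    refine setIntegral_congr_set ?_
    filter_upwards [hnull θ] with x hx
    refine propext ⟨fun hx' => hx'.elim (fun h => h.1) fun h => h.1, fun hx' => ?_⟩
    rcases lt_or_gt_of_ne hx with h1 | h1
    · exact Or.inr ⟨hx', by simpa [hneg] using h1⟩
    · exact Or.inl ⟨hx', h1⟩
  set φ : ℝ → ℝ := fun θ => ∫ x in K ∩ {x | 0 < h θ x}, f x with hφ
  have hφi : ∀ θ, φ θ = ∫ x in K, {x | 0 < h θ x}.indicator f x := fun θ => by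
    rw [setIntegral_indicator (hopen θ).measurableSet]
  -- Off the null hyperplane at angle `θ₀`, the indicator of the half-space is locally constant in
  -- the angle, so dominated convergence applies.
  have hφc : Continuous φ := by
    rw [continuous_iff_continuousAt]
    intro θ₀
    simp only [funext hφi]
    refine continuousAt_of_dominated (bound := fun x => ‖f x‖) ?_ ?_ hf.norm ?_
    · exact Eventually.of_forall fun θ => (hf.indicator (hopen θ).measurableSet).aestronglyMeasurable
    · exact Eventually.of_forall fun θ => ae_of_all _ fun x => norm_indicator_le_norm_self _ _
    · filter_upwards [ae_restrict_of_ae (hnull θ₀)] with x hx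
      rcases lt_or_gt_of_ne hx with h1 | h1
      · have : (fun θ => {x | 0 < h θ x}.indicator f x) =ᶠ[𝓝 θ₀] fun _ => 0 := by
          filter_upwards [(hhθ x).continuousAt.eventually_lt continuousAt_const h1] with θ hθ
          simp [indicator, hθ.le]
        exact this.continuousAt
      · have : (fun θ => {x | 0 < h θ x}.indicator f x) =ᶠ[𝓝 θ₀] fun _ => f x := by
          filter_upwards [continuousAt_const.eventually_lt (hhθ x).continuousAt h1] with θ hθ
          simp [indicator, hθ]
        exact this.continuousAt
  -- Turning by $\pi$ exchanges the two halves, so $\varphi(0)+\varphi(\pi)=0$ and the intermediate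
  -- value theorem gives a zero. Both halves then have zero integral of `f`, and at least one has
  -- positive integral of `g`.
  obtain ⟨θ, hθ⟩ : ∃ θ, φ θ = 0 := by
    have h1 : φ 0 + φ (0 + Real.pi) = 0 := (hsplit f hf 0).trans hf0
    exact mem_range_of_exists_le_of_exists_ge hφc
      (by by_contra! hc; linarith [hc 0, hc (0 + Real.pi)])
      (by by_contra! hc; linarith [hc 0, hc (0 + Real.pi)])
  have hθ' : φ (θ + Real.pi) = 0 := by
    have : φ θ + φ (θ + Real.pi) = 0 := (hsplit f hf θ).trans hf0
    linarith
  have hgs := hsplit g hg θ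
  have main : ∀ θ, φ θ = 0 → 0 < ∫ x in K ∩ {x | 0 < h θ x}, g x →
      ∃ K' ⊆ K, IsOpen K' ∧ Convex ℝ K' ∧ ∫ x in K', f x = 0 ∧ 0 < ∫ x in K', g x ∧
      ∃ α β : ℝ, (α ≠ 0 ∨ β ≠ 0) ∧ ∀ x ∈ K', 0 ≤ coordAffine i j r s α β x := fun θ h1 h2 =>
    ⟨_, inter_subset_left, hKo.inter (hopen θ), hKc.inter (convex_coordAffine_pos _ _ _ _ _ _), h1,
      h2, Real.cos θ, Real.sin θ, hcs θ, fun x hx => hx.2.le⟩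
  by_cases h1 : 0 < ∫ x in K ∩ {x | 0 < h θ x}, g x
  · exact main θ hθ h1
  · exact main _ hθ' (by linarith)

/-- A set which, for all coordinates `i ≠ j` and all rational `r`, `s`, lies on one side of a
hyperplane containing `{x_i = r, x_j = s}` is contained in a line. -/
theorem exists_line_of_coordAffine_nonneg {d : ℕ} (hd : 0 < d) {S : Set (EuclideanSpace ℝ (Fin d))}
    (hS : ∀ i j : Fin d, i ≠ j → ∀ r s : ℚ, ∃ α β : ℝ, (α ≠ 0 ∨ β ≠ 0) ∧
      ∀ x ∈ S, 0 ≤ coordAffine i j r s α β x) :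
    ∃ p e : EuclideanSpace ℝ (Fin d), ‖e‖ = 1 ∧ ∀ x ∈ S, ∃ t : ℝ, x = p + t • e := by
  have hdet : ∀ i j : Fin d, ∀ x ∈ S, ∀ y ∈ S, ∀ z ∈ S,
      (y i - x i) * (z j - x j) - (y j - x j) * (z i - x i) = 0 := by
    intro i j x hx y hy z hz
    rcases eq_or_ne i j with rfl | hij
    · ring
    by_contra hD
    set D := (y i - x i) * (z j - x j) - (y j - x j) * (z i - x i) with hDdef
    -- If the projections of `x`, `y`, `z` to the coordinates `i`, `j` spanned a triangle, `b` and
    -- `c` would be the barycentric weights at `y` and `z` (Cramer's rule). By density some rational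
    -- point `(r, s)` lies strictly inside, with the centroid as witness that the interior is
    -- nonempty.
    let b : ℝ × ℝ → ℝ := fun w => ((w.1 - x i) * (z j - x j) - (w.2 - x j) * (z i - x i)) / D
    let c : ℝ × ℝ → ℝ := fun w => ((y i - x i) * (w.2 - x j) - (y j - x j) * (w.1 - x i)) / D
    have hbc : Continuous b := by fun_prop
    have hcc : Continuous c := by fun_prop
    have hdense : DenseRange (Prod.map ((↑) : ℚ → ℝ) ((↑) : ℚ → ℝ)) :=
      Rat.denseRange_cast.prodMap Rat.denseRange_cast
    obtain ⟨⟨r, s⟩, hb, hc, hbc1⟩ := hdense.exists_mem_open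
      (s := {w | 0 < b w ∧ 0 < c w ∧ b w + c w < 1})
      ((isOpen_lt continuous_const hbc).inter ((isOpen_lt continuous_const hcc).inter
        (isOpen_lt (hbc.add hcc) continuous_const)))
      ⟨(x i + 1 / 3 * (y i - x i) + 1 / 3 * (z i - x i),
        x j + 1 / 3 * (y j - x j) + 1 / 3 * (z j - x j)), by
        have h1 : b (x i + 1 / 3 * (y i - x i) + 1 / 3 * (z i - x i),
          x j + 1 / 3 * (y j - x j) + 1 / 3 * (z j - x j)) = 1 / 3 := by
          simp only [b]; rw [div_eq_iff hD, hDdef]; ring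
        have h2 : c (x i + 1 / 3 * (y i - x i) + 1 / 3 * (z i - x i),
          x j + 1 / 3 * (y j - x j) + 1 / 3 * (z j - x j)) = 1 / 3 := by
          simp only [c]; rw [div_eq_iff hD, hDdef]; ring
        simp only [mem_ofPred_eq, h1, h2]
        norm_num⟩
    obtain ⟨α, β, hαβ, hpos⟩ := hS i j hij r s
    simp only [Prod.map_apply] at hb hc hbc1
    have hX := hpos x hx
    have hY := hpos y hy
    have hZ := hpos z hz
    set B := b ((r : ℝ), (s : ℝ)) with hB
    set C := c ((r : ℝ), (s : ℝ)) with hC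
    have hr : (r : ℝ) = x i + B * (y i - x i) + C * (z i - x i) := by
      simp only [hB, hC, b, c]
      field_simp
      rw [hDdef]; ring
    have hs : (s : ℝ) = x j + B * (y j - x j) + C * (z j - x j) := by
      simp only [hB, hC, b, c]
      field_simp
      rw [hDdef]; ring
    -- The affine function vanishes at the interior point `(r, s)`, a combination of the vertices
    -- with positive weights. Being nonnegative at the vertices it vanishes there too, which forces
    -- `α = β = 0`.
    have hsum : (1 - B - C) * coordAffine i j r s α β x + B * coordAffine i j r s α β y +
        C * coordAffine i j r s α β z = 0 := by
      simp only [coordAffine]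
      rw [hr, hs]; ring
    have h1 := mul_nonneg (by linarith : 0 ≤ 1 - B - C) hX
    have h2 := mul_nonneg hb.le hY
    have h3 := mul_nonneg hc.le hZ
    have hX0 : coordAffine i j r s α β x = 0 :=
      (mul_eq_zero.1 (by linarith : (1 - B - C) * _ = 0)).resolve_left (by linarith)
    have hY0 : coordAffine i j r s α β y = 0 :=
      (mul_eq_zero.1 (by linarith : B * _ = 0)).resolve_left hb.ne'
    have hZ0 : coordAffine i j r s α β z = 0 :=
      (mul_eq_zero.1 (by linarith : C * _ = 0)).resolve_left hc.ne'
    simp only [coordAffine] at hX0 hY0 hZ0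
    rcases hαβ with h | h
    · refine h ((mul_eq_zero.1 (?_ : α * D = 0)).resolve_right hD)
      rw [hDdef]
      linear_combination (z j - x j) * (hY0 - hX0) - (y j - x j) * (hZ0 - hX0)
    · refine h ((mul_eq_zero.1 (?_ : β * D = 0)).resolve_right hD)
      rw [hDdef]
      linear_combination (y i - x i) * (hZ0 - hX0) - (z i - x i) * (hY0 - hX0)
  by_cases hsub : S.Subsingleton
  · have he : ‖(EuclideanSpace.single (⟨0, hd⟩ : Fin d) (1 : ℝ))‖ = 1 := by simp
    rcases S.eq_empty_or_nonempty with rfl | ⟨x, hx⟩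
    · exact ⟨0, _, he, by simp⟩
    · exact ⟨x, _, he, fun y hy => ⟨0, by rw [hsub hy hx]; simp⟩⟩
  · rw [Set.not_subsingleton_iff] at hsub
    obtain ⟨x, hx, y, hy, hxy⟩ := hsub
    have hn : ‖y - x‖ ≠ 0 := norm_ne_zero_iff.2 (sub_ne_zero.2 hxy.symm)
    obtain ⟨i, hi⟩ : ∃ i, y i - x i ≠ 0 := by
      by_contra! h
      exact hxy (by ext i; linarith [h i])
    refine ⟨x, ‖y - x‖⁻¹ • (y - x), by rw [norm_smul, norm_inv, norm_norm, inv_mul_cancel₀ hn],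
      fun z hz => ⟨(z i - x i) / (y i - x i) * ‖y - x‖, ?_⟩⟩
    rw [smul_smul, mul_assoc, mul_inv_cancel₀ hn, mul_one]
    ext j
    have := hdet i j x hx y hy z hz
    simp only [PiLp.add_apply, PiLp.smul_apply, PiLp.sub_apply, smul_eq_mul]
    field_simp
    linarith

/-- Needle decomposition: nested bisections shrink to a subset of a line. -/
theorem exists_needle_sequence {d : ℕ} (hd : 0 < d) {K : Set (EuclideanSpace ℝ (Fin d))}
    (hKo : IsOpen K) (hKc : Convex ℝ K) {f g : EuclideanSpace ℝ (Fin d) → ℝ}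
    (hf : IntegrableOn f K) (hg : IntegrableOn g K) (hf0 : ∫ x in K, f x = 0)
    (hg0 : 0 < ∫ x in K, g x) :
    ∃ (κ : ℕ → Set (EuclideanSpace ℝ (Fin d))) (p e : EuclideanSpace ℝ (Fin d)), Antitone κ ∧
      (∀ n, κ n ⊆ K ∧ IsOpen (κ n) ∧ Convex ℝ (κ n) ∧ ∫ x in κ n, f x = 0 ∧
        0 < ∫ x in κ n, g x) ∧
      ‖e‖ = 1 ∧ ∀ x ∈ ⋂ n, closure (κ n), ∃ t : ℝ, x = p + t • e := by
  let P : Set (EuclideanSpace ℝ (Fin d)) → Prop := fun κ =>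
    κ ⊆ K ∧ IsOpen κ ∧ Convex ℝ κ ∧ ∫ x in κ, f x = 0 ∧ 0 < ∫ x in κ, g x
  let T := {ij : Fin d × Fin d // ij.1 ≠ ij.2} × ℚ × ℚ
  -- The value `none` means no cut; it keeps the index type nonempty for $d=1$, where there are no
  -- pairs `i ≠ j`, so that it can be enumerated by `ℕ`.
  have step : ∀ (o : Option T) (κ : {κ // P κ}), ∃ κ' : {κ // P κ}, κ'.1 ⊆ κ.1 ∧ ∀ t ∈ o,
      ∃ α β : ℝ, (α ≠ 0 ∨ β ≠ 0) ∧ ∀ x ∈ κ'.1,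
        0 ≤ coordAffine t.1.1.1 t.1.1.2 t.2.1 t.2.2 α β x := by
    rintro (_ | t) ⟨κ, h1, h2, h3, h4, h5⟩
    · exact ⟨⟨κ, h1, h2, h3, h4, h5⟩, Subset.rfl, by simp⟩
    · obtain ⟨κ', h1', h2', h3', h4', h5', h6'⟩ := exists_bisection h2 h3 (hf.mono_set h1)
        (hg.mono_set h1) h4 h5 t.1.2 t.2.1 t.2.2
      refine ⟨⟨κ', h1'.trans h1, h2', h3', h4', h5'⟩, h1', ?_⟩
      rintro t' ht'
      obtain rfl : t = t' := by simpa using ht'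
      exact h6'
  choose next hnext hnext' using step
  obtain ⟨cut, hcut⟩ := exists_surjective_nat (Option T)
  let κ : ℕ → {κ // P κ} := fun n =>
    Nat.rec ⟨K, Subset.rfl, hKo, hKc, hf0, hg0⟩ (fun n κ => next (cut n) κ) n
  have hκ : ∀ n, κ (n + 1) = next (cut n) (κ n) := fun n => rfl
  have hline := exists_line_of_coordAffine_nonneg hd (S := ⋂ n, closure (κ n).1) (by
    intro i j hij r s
    obtain ⟨n, hn⟩ := hcut (some (⟨(i, j), hij⟩, r, s))
    obtain ⟨α, β, h1, h2⟩ := hnext' (cut n) (κ n) _ hn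
    refine ⟨α, β, h1, fun x hx => ?_⟩
    have hx' : x ∈ closure (κ (n + 1)).1 := mem_iInter.1 hx (n + 1)
    rw [hκ] at hx'
    exact closure_minimal h2 (isClosed_le continuous_const (continuous_coordAffine _ _ _ _ _ _)) hx')
  obtain ⟨p, e, he, hpe⟩ := hline
  exact ⟨fun n => (κ n).1, p, e, antitone_nat_of_succ_le fun n => by rw [hκ]; exact hnext _ _,
    fun n => (κ n).2, he, hpe⟩

/-! ### The Poincaré inequality on convex sets -/

/-- The Poincaré inequality on a bounded convex open set of diameter at most `H`, for functions of
vanishing integral, with a constant independent of the dimension. -/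
theorem poincare_of_integral_eq_zero {d : ℕ} (hd : 0 < d) {K : Set (EuclideanSpace ℝ (Fin d))}
    (hKo : IsOpen K) (hKc : Convex ℝ K) (hKb : Bornology.IsBounded K) {H : ℝ} (hH : 0 < H)
    (hKH : ∀ x ∈ K, ∀ y ∈ K, dist x y ≤ H) {f : EuclideanSpace ℝ (Fin d) → ℝ}
    (hf : ContDiff ℝ 1 f) (hf0 : ∫ x in K, f x = 0) :
    ∫ x in K, f x ^ 2 ≤ (2 * H / Real.pi) ^ 2 * ∫ x in K, ‖fderiv ℝ f x‖ ^ 2 := by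
  have hint : ∀ u : EuclideanSpace ℝ (Fin d) → ℝ, Continuous u → IntegrableOn u K := fun u hu =>
    (hu.continuousOn.integrableOn_compact hKb.isCompact_closure).mono_set subset_closure
  set q : EuclideanSpace ℝ (Fin d) → ℝ := fun x => ‖fderiv ℝ f x‖ ^ 2 with hq
  have hfc : Continuous f := hf.continuous
  have hqc : Continuous q := ((hf.continuous_fderiv one_ne_zero).norm).pow 2
  set C := (2 * H / Real.pi) ^ 2 with hC
  have hC0 : 0 < C := by positivity
  by_contra! hlt
  set V := volume.real K
  -- A pointwise slack `η` is reserved from the assumed violation; it will absorb the error of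
  -- replacing `f` by its values on the limiting line.
  obtain ⟨η, hη, hηV⟩ : ∃ η > 0, η * V < (∫ x in K, f x ^ 2) - C * ∫ x in K, q x := by
    have hV : 0 ≤ V := measureReal_nonneg
    have hD : 0 < (∫ x in K, f x ^ 2) - C * ∫ x in K, q x := sub_pos.2 hlt
    refine ⟨((∫ x in K, f x ^ 2) - C * ∫ x in K, q x) / (V + 1), by positivity, ?_⟩
    rw [div_mul_eq_mul_div, div_lt_iff₀ (by positivity)]
    linarith
  set g : EuclideanSpace ℝ (Fin d) → ℝ := fun x => f x ^ 2 - C * q x - η with hg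
  have hgc : Continuous g := by fun_prop
  have hg0 : 0 < ∫ x in K, g x := by
    simp only [hg]
    rw [integral_sub (hint _ (by fun_prop)) (hint _ (by fun_prop)),
      integral_sub (hint _ (by fun_prop)) (hint _ (by fun_prop)), integral_const_mul,
      setIntegral_const, smul_eq_mul]
    linarith
  obtain ⟨κ, p, e, hanti, hκ, he, hline⟩ := exists_needle_sequence hd hKo hKc (hint f hfc)
    (hint g hgc) hf0 hg0
  obtain ⟨R, hR⟩ := hKb.subset_closedBall 0
  have hBc : IsCompact (Metric.closedBall (0 : EuclideanSpace ℝ (Fin d)) (R + 1)) :=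
    isCompact_closedBall _ _
  obtain ⟨M, hM0, hM⟩ : ∃ M, 0 ≤ M ∧
      ∀ x ∈ Metric.closedBall (0 : EuclideanSpace ℝ (Fin d)) (R + 1), |f x| ≤ M := by
    obtain ⟨M, hM⟩ := hBc.exists_bound_of_continuousOn hfc.continuousOn
    exact ⟨|M|, abs_nonneg M, fun x hx => (hM x hx).trans (le_abs_self M)⟩
  obtain ⟨ε, hε, hε1⟩ : ∃ ε > 0, C * ε + ε ^ 2 + 2 * M * ε ≤ η := by
    have hS : 0 < C + 1 + 2 * M := by positivity
    refine ⟨min 1 (η / (C + 1 + 2 * M)), by positivity, ?_⟩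
    set ε := min 1 (η / (C + 1 + 2 * M))
    have h0 : 0 ≤ ε := by positivity
    have h1 : ε ≤ 1 := min_le_left _ _
    have h2 : ε * (C + 1 + 2 * M) ≤ η := (le_div_iff₀ hS).1 (min_le_right _ _)
    nlinarith
  obtain ⟨δ, hδ, hδ1, hδf, hδq⟩ : ∃ δ > 0, δ ≤ 1 ∧
      (∀ x ∈ Metric.closedBall (0 : EuclideanSpace ℝ (Fin d)) (R + 1),
        ∀ y ∈ Metric.closedBall (0 : EuclideanSpace ℝ (Fin d)) (R + 1), dist x y < δ →
          |f x - f y| ≤ ε) ∧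
      (∀ x ∈ Metric.closedBall (0 : EuclideanSpace ℝ (Fin d)) (R + 1),
        ∀ y ∈ Metric.closedBall (0 : EuclideanSpace ℝ (Fin d)) (R + 1), dist x y < δ →
          |q x - q y| ≤ ε) := by
    obtain ⟨δ₁, h1, h1'⟩ := Metric.uniformContinuousOn_iff_le.1
      (hBc.uniformContinuousOn_of_continuous hfc.continuousOn) ε hε
    obtain ⟨δ₂, h2, h2'⟩ := Metric.uniformContinuousOn_iff_le.1
      (hBc.uniformContinuousOn_of_continuous hqc.continuousOn) ε hε
    exact ⟨min 1 (min δ₁ δ₂), by positivity, min_le_left _ _,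
      fun x hx y hy hxy => h1' x hx y hy
        (hxy.le.trans ((min_le_right _ _).trans (min_le_left _ _))),
      fun x hx y hy hxy => h2' x hx y hy
        (hxy.le.trans ((min_le_right _ _).trans (min_le_right _ _)))⟩
  -- Decreasing compact sets eventually enter any neighbourhood of their intersection, here a subset
  -- of a line.
  obtain ⟨n, hn⟩ : ∃ n, closure (κ n) ⊆ Metric.thickening δ (⋂ n, closure (κ n)) := by
    refine exists_subset_nhds_of_isCompact (V := fun n => closure (κ n))
      (directed_of_isDirected_le fun m n hmn => closure_mono (hanti hmn))
      (fun n => (hKb.subset (hκ n).1).isCompact_closure) fun x hx => ?_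
    exact Metric.isOpen_thickening.mem_nhds (Metric.self_subset_thickening hδ _ hx)
  obtain ⟨hnK, hno, hnc, hnf, hng⟩ := hκ n
  -- `π` is the orthogonal projection onto the line. It moves points of `κ n` by less than `δ`,
  -- since the projection is the nearest point of the line.
  set π : EuclideanSpace ℝ (Fin d) → EuclideanSpace ℝ (Fin d) := fun x =>
    p + (inner ℝ e x - inner ℝ e p) • e with hπ
  have hπc : Continuous π := by fun_prop
  have hπx : ∀ x ∈ κ n, dist x (π x) < δ := by
    intro x hx
    obtain ⟨y, hy, hxy⟩ := Metric.mem_thickening_iff.1 (hn (subset_closure hx))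
    obtain ⟨t, rfl⟩ := hline y hy
    refine lt_of_le_of_lt ?_ hxy
    have h1 : inner ℝ e e = (1 : ℝ) := by rw [real_inner_self_eq_norm_sq, he, one_pow]
    have h2 : x - π x = (x - (p + t • e)) - (inner ℝ e (x - (p + t • e))) • e := by
      simp only [hπ, inner_sub_right, inner_add_right, inner_smul_right, h1]
      module
    rw [dist_eq_norm, dist_eq_norm, h2]
    set v := x - (p + t • e)
    refine (sq_le_sq₀ (norm_nonneg _) (norm_nonneg _)).1 ?_
    rw [norm_sub_sq_real, inner_smul_right, norm_smul, he, real_inner_comm, Real.norm_eq_abs,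
      mul_one, sq_abs]
    nlinarith [sq_nonneg (inner ℝ e v)]
  set G : ℝ → ℝ := fun t => f (p + (t - inner ℝ e p) • e) with hG
  set G' : ℝ → ℝ := fun t => fderiv ℝ f (p + (t - inner ℝ e p) • e) e with hG'
  have hGd : ∀ t, HasDerivAt G (G' t) t := fun t => by
    have h1 : HasDerivAt (fun t : ℝ => p + (t - inner ℝ e p) • e) e t := by
      have := (((hasDerivAt_id t).sub_const (inner ℝ e p)).smul_const e).const_add p
      rwa [one_smul] at this
    exact ((hf.differentiable one_ne_zero) _).hasFDerivAt.comp_hasDerivAt t h1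
  have hG'c : Continuous G' :=
    ((hf.continuous_fderiv one_ne_zero).comp (by fun_prop)).clm_apply continuous_const
  have hintn : ∀ u : EuclideanSpace ℝ (Fin d) → ℝ, Continuous u → IntegrableOn u (κ n) :=
    fun u hu => (hint u hu).mono_set hnK
  have hn0 : volume (κ n) ≠ 0 := by
    intro h
    rw [setIntegral_measure_zero _ h] at hng
    exact lt_irrefl _ hng
  obtain ⟨c, hc⟩ := lintegral_wirtinger_of_convex hnc hno.measurableSet (hKb.subset hnK) hn0 hH
    (fun x hx y hy => hKH x (hnK hx) y (hnK hy)) he hGd hG'c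
  have hc' : ∫ x in κ n, (f (π x) - G c) ^ 2 ≤ C * ∫ x in κ n, q (π x) := by
    have hG'q : ∀ x, G' (inner ℝ e x) ^ 2 ≤ q (π x) := fun x => by
      have := (fderiv ℝ f (π x)).le_opNorm e
      rw [he, mul_one, Real.norm_eq_abs] at this
      rw [← sq_abs]
      exact pow_le_pow_left₀ (abs_nonneg _) this 2
    have h1 := hc.trans (lintegral_mono fun x => ENNReal.ofReal_le_ofReal (hG'q x))
    rw [← ofReal_integral_eq_lintegral_ofReal, ← ofReal_integral_eq_lintegral_ofReal,
      ENNReal.ofReal_le_ofReal_iff, integral_const_mul] at h1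
    · have h2 : C * (Real.pi / (2 * H)) ^ 2 = 1 := by
        rw [hC]; field_simp
      calc ∫ x in κ n, (f (π x) - G c) ^ 2
          = C * ((Real.pi / (2 * H)) ^ 2 * ∫ x in κ n, (f (π x) - G c) ^ 2) := by
            rw [← mul_assoc, h2, one_mul]
        _ ≤ _ := mul_le_mul_of_nonneg_left h1 hC0.le
    · exact integral_nonneg fun x => by positivity
    · exact hintn _ (by fun_prop)
    · exact ae_of_all _ fun x => by positivity
    · exact hintn _ (by fun_prop)
    · exact ae_of_all _ fun x => by positivity
  -- Replacing `x` by `π x` costs at most `C ε + 2 M ε`. Expanding $(m-(u-f))^2\ge0$ with $m=G(c)$,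
  -- $u=f(\pi x)$ centres the square at $m$, at the price of $\varepsilon^2$ and of a multiple of
  -- `f`, whose integral over `κ n` is zero. The slack `η` covers all the errors, so integration
  -- contradicts $\int g>0$.
  have hpt : ∀ x ∈ κ n, g x ≤ (f (π x) - G c) ^ 2 - C * q (π x) + 2 * G c * f x := by
    intro x hx
    have hxB : x ∈ Metric.closedBall (0 : EuclideanSpace ℝ (Fin d)) (R + 1) :=
      Metric.closedBall_subset_closedBall (by linarith) (hR (hnK hx))
    have hπB : π x ∈ Metric.closedBall (0 : EuclideanSpace ℝ (Fin d)) (R + 1) := by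
      rw [Metric.mem_closedBall] at *
      have h1 := dist_triangle_left (π x) 0 x
      have h2 := Metric.mem_closedBall.1 (hR (hnK hx))
      linarith [hπx x hx]
    have h1 := hδf x hxB _ hπB (hπx x hx)
    have h2 := abs_le.1 (hδq x hxB _ hπB (hπx x hx))
    have h3 := mul_le_mul_of_nonneg_left h2.1 hC0.le
    have h4 := hM x hxB
    have h5 := hM _ hπB
    set m := G c
    set u := f (π x)
    have h6 : f x ^ 2 - u ^ 2 ≤ 2 * M * ε := by
      calc f x ^ 2 - u ^ 2 = (f x - u) * (f x + u) := by ring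
        _ ≤ |(f x - u) * (f x + u)| := le_abs_self _
        _ = |f x + u| * |f x - u| := by rw [abs_mul, mul_comm]
        _ ≤ 2 * M * ε := mul_le_mul (by linarith [abs_add_le (f x) u]) h1 (abs_nonneg _)
            (by positivity)
    have h7 : (f x - u) ^ 2 ≤ ε ^ 2 := by
      rw [← sq_abs]
      exact pow_le_pow_left₀ (abs_nonneg _) h1 2
    simp only [hg]
    linarith [sq_nonneg (m - (u - f x)), show (m - (u - f x)) ^ 2 =
      (u - m) ^ 2 + 2 * m * f x - u ^ 2 + (f x - u) ^ 2 by ring]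
  have := setIntegral_mono_on (hintn g hgc) (hintn _ (by fun_prop)) hno.measurableSet hpt
  rw [integral_add (hintn _ (by fun_prop)) (hintn _ (by fun_prop)),
    integral_sub (hintn (fun x => (f (π x) - G c) ^ 2) (by fun_prop)) (hintn _ (by fun_prop)),
    integral_const_mul, integral_const_mul, hnf] at this
  linarith

/-! ### Constrained energy minimization -/

section Abstract

variable {V : Type*} [AddCommGroup V] [Module ℝ V] {B : V →ₗ[ℝ] V →ₗ[ℝ] ℝ}
  {ι : Type*} {ℓ : ι → V →ₗ[ℝ] ℝ} {w : ι → V}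

/-- Galerkin orthogonality: each `w i` represents the functional `ℓ i` in the form `B`, so vanishing
measurements mean orthogonality to every `w i`. -/
theorem form_eq_zero_of_mem_span (hw : ∀ i v, B v (w i) = ℓ i v) {u v : V} (hu : ∀ i, ℓ i u = 0)
    (hv : v ∈ Submodule.span ℝ (range w)) : B u v = 0 := by
  have : Submodule.span ℝ (range w) ≤ LinearMap.ker (B u) := by
    rw [Submodule.span_le]
    rintro _ ⟨i, rfl⟩
    simp [hw, hu]
  exact this hv

theorem eq_zero_of_mem_span (hp : ∀ v, v ≠ 0 → 0 < B v v) (hw : ∀ i v, B v (w i) = ℓ i v) {v : V}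
    (hv : v ∈ Submodule.span ℝ (range w)) (h : ∀ i, ℓ i v = 0) : v = 0 := by
  by_contra hne
  exact (hp v hne).ne' (form_eq_zero_of_mem_span hw h hv)

theorem form_pythagoras (hs : ∀ v w, B v w = B w v) (hw : ∀ i v, B v (w i) = ℓ i v) {u v : V}
    (hu : ∀ i, ℓ i u = 0) (hv : v ∈ Submodule.span ℝ (range w)) :
    B (u + v) (u + v) = B u u + B v v := by
  have h := form_eq_zero_of_mem_span hw hu hv
  have h' : B v u = 0 := by rw [hs, h]
  simp [h, h']

-- The family `η` dual to the measurements makes the `w i` independent. The measurement map from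
-- their span to `ι → ℝ` is injective by orthogonality and positivity, hence bijective by equality
-- of dimensions.
open Classical in
theorem exists_dual_mem_span [Fintype ι] (hp : ∀ v, v ≠ 0 → 0 < B v v)
    (hw : ∀ i v, B v (w i) = ℓ i v) {η : ι → V}
    (hη : ∀ i j, ℓ j (η i) = if i = j then 1 else 0) :
    ∃ ψ : ι → V, (∀ i, ψ i ∈ Submodule.span ℝ (range w)) ∧
      ∀ i j, ℓ j (ψ i) = if i = j then 1 else 0 := by
  have hli : LinearIndependent ℝ w := by
    rw [Fintype.linearIndependent_iff]
    intro c hc i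
    have := congrArg (B (η i)) hc
    simpa [hw, hη] using this
  let T : Submodule.span ℝ (range w) →ₗ[ℝ] (ι → ℝ) :=
    (LinearMap.pi ℓ).comp (Submodule.subtype _)
  have hT : Function.Injective T := by
    rw [← LinearMap.ker_eq_bot, LinearMap.ker_eq_bot']
    rintro ⟨v, hv⟩ h
    exact Subtype.ext (eq_zero_of_mem_span hp hw hv fun i => congrFun h i)
  have : FiniteDimensional ℝ (Submodule.span ℝ (range w)) :=
    FiniteDimensional.span_of_finite ℝ (finite_range w)
  have hTs : Function.Surjective T :=
    (LinearMap.injective_iff_surjective_of_finrank_eq_finrank (by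
      rw [finrank_span_eq_card hli, Module.finrank_fintype_fun_eq_card])).1 hT
  choose ψ hψ using fun i => hTs (fun j => if i = j then 1 else 0)
  exact ⟨fun i => ψ i, fun i => (ψ i).2, fun i j => congrFun (hψ i) j⟩

-- Subtracting from `w k` its expansion with measured coefficients leaves an element of the span of
-- `w` with zero measurements, which must vanish.
open Classical in
theorem span_dual_eq [Fintype ι] (hp : ∀ v, v ≠ 0 → 0 < B v v) (hw : ∀ i v, B v (w i) = ℓ i v)
    {ψ : ι → V} (hψ : ∀ i, ψ i ∈ Submodule.span ℝ (range w))
    (hψ' : ∀ i j, ℓ j (ψ i) = if i = j then 1 else 0) :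
    Submodule.span ℝ (range ψ) = Submodule.span ℝ (range w) := by
  refine le_antisymm (Submodule.span_le.2 ?_) (Submodule.span_le.2 ?_)
  · rintro _ ⟨i, rfl⟩
    exact hψ i
  · rintro _ ⟨k, rfl⟩
    have hsum : ∑ j, ℓ j (w k) • ψ j ∈ Submodule.span ℝ (range ψ) :=
      Submodule.sum_mem _ fun j _ => Submodule.smul_mem _ _ (Submodule.subset_span ⟨j, rfl⟩)
    have h0 : w k - ∑ j, ℓ j (w k) • ψ j = 0 := by
      refine eq_zero_of_mem_span hp hw (Submodule.sub_mem _ (Submodule.subset_span ⟨k, rfl⟩)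
        (Submodule.sum_mem _ fun j _ => Submodule.smul_mem _ _ (hψ j))) fun i => ?_
      simp [hψ']
    rw [sub_eq_zero.1 h0]
    exact hsum

/-- Pythagoras applied to $u-v=(u-u')+(u'-v)$, the second term lying in the span. -/
theorem sqrt_form_eq_iInf (hs : ∀ v w, B v w = B w v) (hp : ∀ v, v ≠ 0 → 0 < B v v)
    (hw : ∀ i v, B v (w i) = ℓ i v) {u u' : V} (hu' : u' ∈ Submodule.span ℝ (range w))
    (h : ∀ i, ℓ i (u - u') = 0) :
    Real.sqrt (B (u - u') (u - u')) =
      ⨅ v : Submodule.span ℝ (range w), Real.sqrt (B (u - v) (u - v)) := by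
  refine le_antisymm (le_ciInf fun v => Real.sqrt_le_sqrt ?_) ?_
  · have := form_pythagoras hs hw h (Submodule.sub_mem _ hu' v.2)
    rw [show u - u' + (u' - (v : V)) = u - v by abel] at this
    have hnn : 0 ≤ B (u' - v) (u' - v) := by
      rcases eq_or_ne (u' - (v : V)) 0 with h0 | h0
      · simp [h0]
      · exact (hp _ h0).le
    linarith
  · exact ciInf_le (f := fun v : Submodule.span ℝ (range w) => Real.sqrt (B (u - v) (u - v)))
      ⟨0, by rintro _ ⟨v, rfl⟩; exact Real.sqrt_nonneg _⟩ ⟨u', hu'⟩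

end Abstract

/-- Lax–Milgram; symmetry of `B` moves the solution into the second argument. -/
theorem exists_riesz_of_coercive {V : Type*} [NormedAddCommGroup V] [InnerProductSpace ℝ V]
    [CompleteSpace V] {B : V →L[ℝ] V →L[ℝ] ℝ} (hs : ∀ v w, B v w = B w v) (hB : IsCoercive B)
    (ℓ : V →L[ℝ] ℝ) : ∃ w, ∀ v, B v w = ℓ v := by
  refine ⟨hB.continuousLinearEquivOfBilin.symm ((InnerProductSpace.toDual ℝ V).symm ℓ),
    fun v => ?_⟩
  rw [hs, ← hB.continuousLinearEquivOfBilin_apply, ContinuousLinearEquiv.apply_symm_apply,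
    InnerProductSpace.toDual_symm_apply]

/-- Homogeneity: the quadratic bound is applied to the normalized vectors. -/
theorem abs_form_le_of_abs_form_le_sq {V : Type*} [NormedAddCommGroup V] [NormedSpace ℝ V]
    {B : V →ₗ[ℝ] V →ₗ[ℝ] ℝ} {c : ℝ} (h : ∀ v w, |B v w| ≤ c * (‖v‖ ^ 2 + ‖w‖ ^ 2)) (v w : V) :
    |B v w| ≤ 2 * c * ‖v‖ * ‖w‖ := by
  rcases eq_or_ne v 0 with rfl | hv
  · simp
  rcases eq_or_ne w 0 with rfl | hw
  · simp
  have hv' : 0 < ‖v‖ := norm_pos_iff.2 hv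
  have hw' : 0 < ‖w‖ := norm_pos_iff.2 hw
  have h1 := h (‖v‖⁻¹ • v) (‖w‖⁻¹ • w)
  simp only [map_smul, LinearMap.smul_apply, smul_eq_mul, norm_smul, norm_inv, norm_norm, abs_mul,
    abs_inv, abs_norm, inv_mul_cancel₀ hv'.ne', inv_mul_cancel₀ hw'.ne'] at h1
  have h2 : |B v w| = ‖v‖ * ‖w‖ * (‖w‖⁻¹ * (‖v‖⁻¹ * |B v w|)) := by field_simp
  rw [h2]
  calc _ ≤ ‖v‖ * ‖w‖ * (c * (1 ^ 2 + 1 ^ 2)) := by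
        refine mul_le_mul_of_nonneg_left ?_ (by positivity)
        linarith
    _ = _ := by ring

/-! ### The energy form -/

section Energy

variable {d : ℕ} {Ω : Set (EuclideanSpace ℝ (Fin d))}
  {a : EuclideanSpace ℝ (Fin d) → Matrix (Fin d) (Fin d) ℝ} {lmin lmax : ℝ}

@[simp] theorem val_smul (c : ℝ) (u : H10 Ω) : val (c • u) = c • val u := rfl
@[simp] theorem grad_add (u v : H10 Ω) : grad (u + v) = grad u + grad v := rfl
@[simp] theorem grad_smul (c : ℝ) (u : H10 Ω) : grad (c • u) = c • grad u := rfl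

theorem norm_sq_eq (u : H10 Ω) : ‖u‖ ^ 2 = ‖val u‖ ^ 2 + ‖grad u‖ ^ 2 :=
  WithLp.prod_norm_sq_eq_of_L2 (u : L2Pair Ω)

theorem norm_grad_le (u : H10 Ω) : ‖grad u‖ ≤ ‖u‖ := by
  refine (sq_le_sq₀ (norm_nonneg _) (norm_nonneg _)).1 ?_
  rw [norm_sq_eq]
  linarith [sq_nonneg ‖val u‖]

instance : CompleteSpace (H10 Ω) :=
  inferInstanceAs (CompleteSpace (testPairs Ω).topologicalClosure)

theorem norm_sq_eq_integral {F : Type*} [NormedAddCommGroup F] [InnerProductSpace ℝ F]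
    {α : Type*} [MeasurableSpace α] {μ : Measure α} (u : Lp F 2 μ) :
    ‖u‖ ^ 2 = ∫ x, ‖u x‖ ^ 2 ∂μ := by
  rw [← real_inner_self_eq_norm_sq, L2.inner_def]
  simp

theorem integrable_norm_sq {F : Type*} [NormedAddCommGroup F] [InnerProductSpace ℝ F]
    {α : Type*} [MeasurableSpace α] {μ : Measure α} (u : Lp F 2 μ) :
    Integrable (fun x => ‖u x‖ ^ 2) μ :=
  (Lp.memLp u).integrable_norm_pow (by norm_num)

theorem dotProduct_self_ofLp (x : EuclideanSpace ℝ (Fin d)) : x.ofLp ⬝ᵥ x.ofLp = ‖x‖ ^ 2 := by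
  rw [EuclideanSpace.real_norm_sq_eq]
  simp [dotProduct, sq]

/-- Nonnegativity of the quadratic form at $v\pm w$ gives $2|v^TAw|\le v^TAv+w^TAw$, and the upper
bound finishes. -/
theorem abs_dotProduct_mulVec_le {A : Matrix (Fin d) (Fin d) ℝ} {m M : ℝ} (hm : 0 < m)
    (hA : A.IsSymm) (hl : ∀ l : Fin d → ℝ, m * (l ⬝ᵥ l) ≤ l ⬝ᵥ (A *ᵥ l))
    (hu : ∀ l : Fin d → ℝ, l ⬝ᵥ (A *ᵥ l) ≤ M * (l ⬝ᵥ l)) (v w : EuclideanSpace ℝ (Fin d)) :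
    |v.ofLp ⬝ᵥ (A *ᵥ w.ofLp)| ≤ M / 2 * (‖v‖ ^ 2 + ‖w‖ ^ 2) := by
  have hsymm : w.ofLp ⬝ᵥ (A *ᵥ v.ofLp) = v.ofLp ⬝ᵥ (A *ᵥ w.ofLp) := by
    rw [Matrix.dotProduct_mulVec, ← Matrix.mulVec_transpose, hA, dotProduct_comm]
  have hnn : ∀ l : Fin d → ℝ, 0 ≤ l ⬝ᵥ (A *ᵥ l) := fun l =>
    (mul_nonneg hm.le (Finset.sum_nonneg fun i _ => mul_self_nonneg (l i))).trans (hl l)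
  have h1 := hu (v.ofLp + w.ofLp)
  have h2 := hnn (v.ofLp - w.ofLp)
  have h3 := hu (v.ofLp - w.ofLp)
  have h4 := hnn (v.ofLp + w.ofLp)
  simp only [Matrix.mulVec_add, Matrix.mulVec_sub, dotProduct_add, dotProduct_sub, add_dotProduct,
    sub_dotProduct, hsymm, dotProduct_self_ofLp, dotProduct_comm w.ofLp v.ofLp] at h1 h2 h3 h4
  rw [abs_le]
  constructor
  · have := hu v.ofLp; have := hu w.ofLp
    simp only [dotProduct_self_ofLp] at *
    linarith
  · have := hu v.ofLp; have := hu w.ofLp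
    simp only [dotProduct_self_ofLp] at *
    linarith

theorem IsElliptic.ae_abs_le (ha : IsElliptic Ω a lmin lmax) (F G : L2Vec Ω) :
    ∀ᵐ x ∂(volume.restrict Ω), |(F x).ofLp ⬝ᵥ (a x *ᵥ (G x).ofLp)| ≤
      lmax / 2 * (‖F x‖ ^ 2 + ‖G x‖ ^ 2) := by
  filter_upwards [ha.symm, ha.lower, ha.upper] with x h1 h2 h3
  exact abs_dotProduct_mulVec_le ha.pos h1 h2 h3 _ _

theorem IsElliptic.integrable (ha : IsElliptic Ω a lmin lmax) (F G : L2Vec Ω) :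
    Integrable (fun x => (F x).ofLp ⬝ᵥ (a x *ᵥ (G x).ofLp)) (volume.restrict Ω) := by
  have hmeas : ∀ (F : L2Vec Ω) (i : Fin d),
      AEStronglyMeasurable (fun x => (F x).ofLp i) (volume.restrict Ω) := fun F i =>
    (EuclideanSpace.proj i : EuclideanSpace ℝ (Fin d) →L[ℝ] ℝ).continuous.comp_aestronglyMeasurable
      (Lp.aestronglyMeasurable F)
  refine Integrable.mono' (((integrable_norm_sq F).add (integrable_norm_sq G)).const_mul
    (lmax / 2)) ?_ (ha.ae_abs_le F G)
  simp only [dotProduct, Matrix.mulVec]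
  exact Finset.aestronglyMeasurable_fun_sum _ fun i _ => (hmeas F i).mul
    (Finset.aestronglyMeasurable_fun_sum _ fun j _ => (ha.measurable i j).mul (hmeas G j))

/-- The energy scalar product as a bilinear form. -/
def energyForm (ha : IsElliptic Ω a lmin lmax) : H10 Ω →ₗ[ℝ] H10 Ω →ₗ[ℝ] ℝ :=
  LinearMap.mk₂ ℝ (energyInner a)
    (fun u v w => by
      rw [energyInner, energyInner, energyInner, ← integral_add (ha.integrable _ _)
        (ha.integrable _ _)]
      refine integral_congr_ae ?_
      filter_upwards [Lp.coeFn_add (grad u) (grad v)] with x hx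
      rw [grad_add, hx]
      simp [add_dotProduct])
    (fun c u v => by
      rw [energyInner, energyInner, smul_eq_mul, ← integral_const_mul]
      refine integral_congr_ae ?_
      filter_upwards [Lp.coeFn_smul c (grad u)] with x hx
      simp [hx])
    (fun u v w => by
      rw [energyInner, energyInner, energyInner, ← integral_add (ha.integrable _ _)
        (ha.integrable _ _)]
      refine integral_congr_ae ?_
      filter_upwards [Lp.coeFn_add (grad v) (grad w)] with x hx
      rw [grad_add, hx]
      simp [Matrix.mulVec_add, dotProduct_add])
    (fun c u v => by
      rw [energyInner, energyInner, smul_eq_mul, ← integral_const_mul]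
      refine integral_congr_ae ?_
      filter_upwards [Lp.coeFn_smul c (grad v)] with x hx
      simp [hx, Matrix.mulVec_smul])

@[simp] theorem energyForm_apply (ha : IsElliptic Ω a lmin lmax) (u v : H10 Ω) :
    energyForm ha u v = energyInner a u v := rfl

theorem energyForm_comm (ha : IsElliptic Ω a lmin lmax) (u v : H10 Ω) :
    energyForm ha u v = energyForm ha v u := by
  refine integral_congr_ae ?_
  filter_upwards [ha.symm] with x hx
  rw [Matrix.dotProduct_mulVec, ← Matrix.mulVec_transpose, hx, dotProduct_comm]

theorem abs_energyForm_le (ha : IsElliptic Ω a lmin lmax) (u v : H10 Ω) :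
    |energyForm ha u v| ≤ |lmax| * ‖u‖ * ‖v‖ := by
  have key : ∀ u v, |energyForm ha u v| ≤ |lmax| / 2 * (‖u‖ ^ 2 + ‖v‖ ^ 2) := fun u v => by
    calc |energyForm ha u v| ≤ ∫ x in Ω, |(grad u x).ofLp ⬝ᵥ (a x *ᵥ (grad v x).ofLp)| :=
          abs_integral_le_integral_abs
      _ ≤ ∫ x in Ω, lmax / 2 * (‖grad u x‖ ^ 2 + ‖grad v x‖ ^ 2) :=
          integral_mono_ae (ha.integrable _ _).abs
            (((integrable_norm_sq _).add (integrable_norm_sq _)).const_mul _) (ha.ae_abs_le _ _)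
      _ = lmax / 2 * (‖grad u‖ ^ 2 + ‖grad v‖ ^ 2) := by
          rw [integral_const_mul, integral_add (integrable_norm_sq _) (integrable_norm_sq _),
            norm_sq_eq_integral (grad u), norm_sq_eq_integral (grad v)]
      _ ≤ |lmax| / 2 * (‖u‖ ^ 2 + ‖v‖ ^ 2) := by
          gcongr
          · exact le_abs_self _
          · exact norm_grad_le u
          · exact norm_grad_le v
  have := abs_form_le_of_abs_form_le_sq key u v
  linarith

theorem lmin_mul_norm_grad_sq_le (ha : IsElliptic Ω a lmin lmax) (u : H10 Ω) :
    lmin * ‖grad u‖ ^ 2 ≤ energyForm ha u u := by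
  rw [norm_sq_eq_integral, ← integral_const_mul]
  refine integral_mono_ae ((integrable_norm_sq _).const_mul _) (ha.integrable _ _) ?_
  filter_upwards [ha.lower] with x hx
  simpa [dotProduct_self_ofLp] using hx (grad u x).ofLp

/-! ### Density of test functions, Friedrichs' inequality and coercivity -/

/-- Properties of the pairs `(η, ∇η)` that are closed in `H¹` extend to `H¹₀`. -/
theorem H10_induction {P : L2Pair Ω → Prop} (hP : IsClosed {p | P p})
    (h : ∀ (p : L2Pair Ω) (η : EuclideanSpace ℝ (Fin d) → ℝ), ContDiff ℝ ∞ η →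
      HasCompactSupport η → tsupport η ⊆ Ω → p.fst =ᵐ[volume.restrict Ω] η →
      p.snd =ᵐ[volume.restrict Ω] gradient η → P p) (u : H10 Ω) : P u := by
  have : (closure (testPairs Ω : Set (L2Pair Ω))) ⊆ {p | P p} := by
    refine closure_minimal ?_ hP
    rintro p ⟨η, h1, h2, h3, h4, h5⟩
    exact h p η h1 h2 h3 h4 h5
  exact this u.2

theorem norm_gradient (f : EuclideanSpace ℝ (Fin d) → ℝ) (x : EuclideanSpace ℝ (Fin d)) :
    ‖gradient f x‖ = ‖fderiv ℝ f x‖ := by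
  simp [gradient]

/-- Integration by parts of $\eta^2$ against the linear function `c`, whose derivative along `e` is
1. -/
theorem integral_sq_eq_neg_integral {η : EuclideanSpace ℝ (Fin d) → ℝ} (h1 : ContDiff ℝ 1 η)
    (h2 : HasCompactSupport η) (c : EuclideanSpace ℝ (Fin d) →L[ℝ] ℝ)
    {e : EuclideanSpace ℝ (Fin d)} (hce : c e = 1) :
    ∫ x, η x ^ 2 = -∫ x, 2 * η x * fderiv ℝ η x e * c x := by
  have hηc : Continuous η := h1.continuous
  have hηd : Continuous fun x => fderiv ℝ η x e :=
    (h1.continuous_fderiv one_ne_zero).clm_apply continuous_const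
  have hdiff : ∀ x, DifferentiableAt ℝ η x := fun x => h1.differentiable one_ne_zero x
  have hcs : ∀ u : EuclideanSpace ℝ (Fin d) → ℝ, Continuous u → (∀ x, η x = 0 → u x = 0) →
      Integrable u := fun u hu h0 =>
    hu.integrable_of_hasCompactSupport (h2.mono fun x hx h => hx (h0 x h))
  have hsq : ∀ x, fderiv ℝ (fun x => η x ^ 2) x e = 2 * η x * fderiv ℝ η x e := fun x => by
    rw [fderiv_fun_pow 2 (hdiff x)]
    simp
  have hce' : ∀ x, fderiv ℝ (fun x => c x) x e = 1 := fun x => by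
    rw [c.fderiv, hce]
  have hparts := integral_mul_fderiv_eq_neg_fderiv_mul_of_integrable
    (μ := (volume : Measure (EuclideanSpace ℝ (Fin d)))) (f := fun x => η x ^ 2)
    (g := fun x => c x) (v := e)
    (by
      simp only [hsq]
      exact hcs _ (by fun_prop) fun x hx => by simp [hx])
    (by
      simp only [hce']
      exact hcs _ (by fun_prop) fun x hx => by simp [hx])
    (hcs _ (by fun_prop) fun x hx => by simp [hx])
    (fun x _ => (hdiff x).pow 2) (fun x _ => c.differentiableAt)
  simpa only [hce', hsq, mul_one] using hparts

/-- Friedrichs' inequality for test functions. -/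
theorem integral_sq_le_of_tsupport_subset (hd : 0 < d) {R : ℝ} (hΩR : ∀ x ∈ Ω, ‖x‖ ≤ R)
    {η : EuclideanSpace ℝ (Fin d) → ℝ} (h1 : ContDiff ℝ 1 η) (h2 : HasCompactSupport η)
    (h3 : tsupport η ⊆ Ω) : ∫ x, η x ^ 2 ≤ 4 * R ^ 2 * ∫ x, ‖fderiv ℝ η x‖ ^ 2 := by
  obtain ⟨c, e, hce, he, hcn⟩ : ∃ (c : EuclideanSpace ℝ (Fin d) →L[ℝ] ℝ)
      (e : EuclideanSpace ℝ (Fin d)), c e = 1 ∧ ‖e‖ = 1 ∧ ∀ x, |c x| ≤ ‖x‖ :=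
    ⟨EuclideanSpace.proj ⟨0, hd⟩, EuclideanSpace.single ⟨0, hd⟩ 1, by simp, by simp,
      fun x => PiLp.norm_apply_le x _⟩
  have hηc : Continuous η := h1.continuous
  have hηd : Continuous (fderiv ℝ η) := h1.continuous_fderiv one_ne_zero
  have hηe : Continuous fun x => fderiv ℝ η x e := hηd.clm_apply continuous_const
  have hcs : ∀ u : EuclideanSpace ℝ (Fin d) → ℝ, Continuous u → (∀ x, η x = 0 → u x = 0) →
      Integrable u := fun u hu h0 =>
    hu.integrable_of_hasCompactSupport (h2.mono fun x hx h => hx (h0 x h))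
  have hdint : Integrable fun x => ‖fderiv ℝ η x‖ ^ 2 := by
    refine (hηd.norm.pow 2).integrable_of_hasCompactSupport ((h2.fderiv (𝕜 := ℝ)).mono ?_)
    intro x hx h
    exact hx (by rw [Pi.pow_apply, h, norm_zero, sq, mul_zero])
  have hsqint : Integrable fun x => η x ^ 2 := hcs _ (by fun_prop) fun x hx => by simp [hx]
  have hpt : ∀ x, -(2 * η x * fderiv ℝ η x e * c x) ≤
      1 / 2 * η x ^ 2 + 2 * R ^ 2 * ‖fderiv ℝ η x‖ ^ 2 := by
    intro x
    by_cases hx : η x = 0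
    · rw [hx, mul_zero, zero_mul, zero_mul, neg_zero]
      positivity
    · have hxR : |c x| ≤ R := (hcn x).trans (hΩR x (h3 (subset_tsupport η hx)))
      have hR0 : 0 ≤ R := (abs_nonneg _).trans hxR
      have hD : |fderiv ℝ η x e| ≤ ‖fderiv ℝ η x‖ := by
        have := (fderiv ℝ η x).le_opNorm e
        rwa [he, mul_one] at this
      have hprod : |fderiv ℝ η x e * c x| ≤ R * ‖fderiv ℝ η x‖ := by
        rw [abs_mul, mul_comm]
        exact mul_le_mul hxR hD (abs_nonneg _) hR0
      have hsq' : (fderiv ℝ η x e * c x) ^ 2 ≤ R ^ 2 * ‖fderiv ℝ η x‖ ^ 2 := by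
        rw [← sq_abs, ← mul_pow]
        exact pow_le_pow_left₀ (abs_nonneg _) hprod 2
      -- Young's inequality weighted so that half of $\int\eta^2$ can be absorbed on the left; this
      -- produces the constant $4R^2$.
      nlinarith [sq_nonneg (η x + 2 * (fderiv ℝ η x e * c x))]
  have hle := integral_mono (hcs (fun x => -(2 * η x * fderiv ℝ η x e * c x)) (by fun_prop)
    fun x hx => by simp [hx])
    (g := fun x => 1 / 2 * η x ^ 2 + 2 * R ^ 2 * ‖fderiv ℝ η x‖ ^ 2)
    ((hsqint.const_mul _).add (hdint.const_mul _)) hpt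
  rw [integral_neg, ← integral_sq_eq_neg_integral h1 h2 c hce,
    integral_add (hsqint.const_mul _) (hdint.const_mul _), integral_const_mul,
    integral_const_mul] at hle
  linarith

theorem continuous_gradient {η : EuclideanSpace ℝ (Fin d) → ℝ} (h : ContDiff ℝ 1 η) :
    Continuous (gradient η) :=
  (InnerProductSpace.toDual ℝ (EuclideanSpace ℝ (Fin d))).symm.continuous.comp
    (h.continuous_fderiv one_ne_zero)

/-- Friedrichs' inequality. -/
theorem exists_norm_val_le (hd : 0 < d) (hΩb : Bornology.IsBounded Ω) :
    ∃ c > 0, ∀ u : H10 Ω, ‖val u‖ ^ 2 ≤ c * ‖grad u‖ ^ 2 := by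
  obtain ⟨R, hR⟩ := hΩb.exists_norm_le
  refine ⟨4 * R ^ 2 + 1, by positivity, fun u => ?_⟩
  refine H10_induction (P := fun p => ‖p.fst‖ ^ 2 ≤ (4 * R ^ 2 + 1) * ‖p.snd‖ ^ 2)
    (isClosed_le (by fun_prop) (by fun_prop)) (fun p η h1 h2 h3 h4 h5 => ?_) u
  have hout : ∀ x, x ∉ Ω → η x = 0 ∧ fderiv ℝ η x = 0 := fun x hx =>
    ⟨image_eq_zero_of_notMem_tsupport fun h => hx (h3 h),
      image_eq_zero_of_notMem_tsupport fun h => hx (h3 (tsupport_fderiv_subset ℝ h))⟩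
  have e1 : ‖p.fst‖ ^ 2 = ∫ x, η x ^ 2 := by
    rw [norm_sq_eq_integral, ← setIntegral_eq_integral_of_forall_compl_eq_zero (s := Ω)
      (f := fun x => η x ^ 2) fun x hx => by simp [(hout x hx).1]]
    refine integral_congr_ae ?_
    filter_upwards [h4] with x hx
    simp [hx]
  have e2 : ‖p.snd‖ ^ 2 = ∫ x, ‖fderiv ℝ η x‖ ^ 2 := by
    rw [norm_sq_eq_integral, ← setIntegral_eq_integral_of_forall_compl_eq_zero (s := Ω)
      (f := fun x => ‖fderiv ℝ η x‖ ^ 2) fun x hx => by simp [(hout x hx).2]]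
    refine integral_congr_ae ?_
    filter_upwards [h5] with x hx
    simp [hx, norm_gradient]
  have := integral_sq_le_of_tsupport_subset hd hR (h1.of_le (by simp)) h2 h3
  rw [← e1, ← e2] at this
  linarith [sq_nonneg ‖p.snd‖]

/-- The energy scalar product as a continuous bilinear form. -/
def energyCLM (ha : IsElliptic Ω a lmin lmax) : H10 Ω →L[ℝ] H10 Ω →L[ℝ] ℝ :=
  (energyForm ha).mkContinuous₂ |lmax| fun u v => by
    rw [Real.norm_eq_abs]; exact abs_energyForm_le ha u v

theorem isCoercive_energyCLM (hd : 0 < d) (hΩb : Bornology.IsBounded Ω)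
    (ha : IsElliptic Ω a lmin lmax) : IsCoercive (energyCLM ha) := by
  obtain ⟨c, hc, h⟩ := exists_norm_val_le hd hΩb
  have hpos := ha.pos
  refine ⟨lmin / (c + 1), by positivity, fun u => ?_⟩
  have h1 := lmin_mul_norm_grad_sq_le ha u
  have h2 : ‖u‖ ^ 2 ≤ (c + 1) * ‖grad u‖ ^ 2 := by
    rw [norm_sq_eq]; linarith [h u]
  calc lmin / (c + 1) * ‖u‖ * ‖u‖ = lmin / (c + 1) * ‖u‖ ^ 2 := by ring
    _ ≤ lmin / (c + 1) * ((c + 1) * ‖grad u‖ ^ 2) := by gcongr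
    _ = lmin * ‖grad u‖ ^ 2 := by field_simp
    _ ≤ energyForm ha u u := h1

theorem energyForm_pos (hd : 0 < d) (hΩb : Bornology.IsBounded Ω)
    (ha : IsElliptic Ω a lmin lmax) (u : H10 Ω) (hu : u ≠ 0) : 0 < energyForm ha u u := by
  obtain ⟨c, hc, h⟩ := isCoercive_energyCLM hd hΩb ha
  have : 0 < ‖u‖ := norm_pos_iff.2 hu
  exact (by positivity : 0 < c * ‖u‖ * ‖u‖).trans_le (h u)

/-! ### Measurements -/

theorem integral_mul_eq_inner {φ : EuclideanSpace ℝ (Fin d) → ℝ}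
    (hφ : MemLp φ 2 (volume.restrict Ω)) (u : L2 Ω) :
    ∫ x in Ω, φ x * u x = inner ℝ (hφ.toLp φ) u := by
  rw [L2.inner_def]
  refine integral_congr_ae ?_
  filter_upwards [hφ.coeFn_toLp] with x hx
  simp [hx, mul_comm]

/-- The measurement by a square integrable function as a continuous linear functional. -/
def measurementCLM {φ : EuclideanSpace ℝ (Fin d) → ℝ} (hφ : MemLp φ 2 (volume.restrict Ω)) :
    H10 Ω →L[ℝ] ℝ :=
  (innerSL ℝ (hφ.toLp φ)).comp ((WithLp.fstL 2 ℝ (L2 Ω) (L2Vec Ω)).comp (H10 Ω).subtypeL)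

theorem measurementCLM_apply {φ : EuclideanSpace ℝ (Fin d) → ℝ}
    (hφ : MemLp φ 2 (volume.restrict Ω)) (u : H10 Ω) : measurementCLM hφ u = measurement φ u :=
  (integral_mul_eq_inner hφ (val u)).symm

theorem abs_measurement_le (g : L2 Ω) (u : H10 Ω) : |measurement g u| ≤ ‖g‖ * ‖val u‖ := by
  have := integral_mul_eq_inner (Lp.memLp g) (val u)
  rw [Lp.toLp_coeFn] at this
  rw [measurement, this]
  exact abs_real_inner_le_norm _ _

/-- Existence and uniqueness of weak solutions. -/
theorem existsUnique_isWeakSolution (hd : 0 < d) (hΩb : Bornology.IsBounded Ω)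
    (ha : IsElliptic Ω a lmin lmax) {φ : EuclideanSpace ℝ (Fin d) → ℝ}
    (hφ : MemLp φ 2 (volume.restrict Ω)) : ∃! u : H10 Ω, IsWeakSolution a φ u := by
  obtain ⟨w, hw⟩ := exists_riesz_of_coercive (B := energyCLM ha) (energyForm_comm ha)
    (isCoercive_energyCLM hd hΩb ha) (measurementCLM hφ)
  refine ⟨w, fun v => (hw v).trans (measurementCLM_apply hφ v), fun w' hw' => ?_⟩
  by_contra hne
  refine (energyForm_pos hd hΩb ha _ (sub_ne_zero.2 hne)).ne' ?_
  have h1 : energyForm ha (w' - w) w' = measurement φ (w' - w) := hw' (w' - w)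
  have h2 : energyForm ha (w' - w) w = measurement φ (w' - w) :=
    (hw _).trans (measurementCLM_apply hφ _)
  rw [map_sub, h1, h2, sub_self]

end Energy

/-! ### The Poincaré inequality on convex cells -/

section Cells

variable {d : ℕ} {Ω : Set (EuclideanSpace ℝ (Fin d))}

/-- Test functions approximating a zero-mean function need not have zero mean. Keeping the mean as
an explicit extra term gives an inequality that is closed in $H^1$ and so passes to the limit. -/
theorem poincare_of_contDiff (hd : 0 < d) {K : Set (EuclideanSpace ℝ (Fin d))}
    (hKo : IsOpen K) (hKc : Convex ℝ K) (hKb : Bornology.IsBounded K) (hK0 : volume K ≠ 0)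
    {H : ℝ} (hH : 0 < H) (hKH : ∀ x ∈ K, ∀ y ∈ K, dist x y ≤ H)
    {f : EuclideanSpace ℝ (Fin d) → ℝ} (hf : ContDiff ℝ 1 f) :
    ∫ x in K, f x ^ 2 ≤ (2 * H / Real.pi) ^ 2 * (∫ x in K, ‖fderiv ℝ f x‖ ^ 2) +
      (∫ x in K, f x) ^ 2 / volume.real K := by
  have hint : ∀ u : EuclideanSpace ℝ (Fin d) → ℝ, Continuous u → IntegrableOn u K := fun u hu =>
    (hu.continuousOn.integrableOn_compact hKb.isCompact_closure).mono_set subset_closure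
  have hfc : Continuous f := hf.continuous
  have hV : 0 < volume.real K := ENNReal.toReal_pos hK0 hKb.measure_lt_top.ne
  set m := (∫ x in K, f x) / volume.real K with hm
  have hm' : ∫ x in K, f x = m * volume.real K := by rw [hm]; field_simp
  have h0 : ∫ x in K, (f x - m) = 0 := by
    rw [integral_sub (hint _ hfc) (hint _ continuous_const), setIntegral_const, smul_eq_mul, hm']
    ring
  have h1 := poincare_of_integral_eq_zero hd hKo hKc hKb hH hKH
    (f := fun x => f x - m) (hf.sub contDiff_const) h0
  have h2 : ∫ x in K, (f x - m) ^ 2 = (∫ x in K, f x ^ 2) - m ^ 2 * volume.real K := by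
    have : ∀ x, (f x - m) ^ 2 = f x ^ 2 - 2 * m * (f x - m) - m ^ 2 := fun x => by ring
    simp only [this]
    rw [integral_sub (hint _ (by fun_prop)) (hint _ (by fun_prop)),
      integral_sub (hint _ (by fun_prop)) (hint _ (by fun_prop)), integral_const_mul, h0,
      setIntegral_const, smul_eq_mul]
    ring
  simp only [fderiv_sub_const, h2] at h1
  have h3 : (m * volume.real K) ^ 2 / volume.real K = m ^ 2 * volume.real K := by field_simp
  rw [hm', h3]
  linarith

/-- Writing the integral over a cell as the norm of a continuous restriction operator makes it
visibly continuous, as the density argument in `poincare_H10` requires. -/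
theorem norm_sq_restrict {F : Type*} [NormedAddCommGroup F] [InnerProductSpace ℝ F]
    {K : Set (EuclideanSpace ℝ (Fin d))} (hK : K ⊆ Ω)
    (u : Lp F 2 (volume.restrict Ω)) :
    ‖LpToLpRestrictCLM _ F ℝ (volume.restrict Ω) 2 K u‖ ^ 2 = ∫ x in K, ‖u x‖ ^ 2 := by
  have h := LpToLpRestrictCLM_coeFn (p := 2) ℝ K u
  rw [norm_sq_eq_integral]
  have h' : ∫ x, ‖LpToLpRestrictCLM _ F ℝ (volume.restrict Ω) 2 K u x‖ ^ 2
      ∂((volume.restrict Ω).restrict K) = ∫ x, ‖u x‖ ^ 2 ∂((volume.restrict Ω).restrict K) := by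
    refine integral_congr_ae ?_
    filter_upwards [h] with x hx
    rw [hx]
  rw [h', Measure.restrict_restrict_of_subset hK]

theorem poincare_H10 (hd : 0 < d) {K : Set (EuclideanSpace ℝ (Fin d))}
    (hKo : IsOpen K) (hKc : Convex ℝ K) (hKb : Bornology.IsBounded K) (hK0 : volume K ≠ 0)
    {H : ℝ} (hH : 0 < H) (hKH : ∀ x ∈ K, ∀ y ∈ K, dist x y ≤ H) (hKΩ : K ⊆ Ω)
    (u : H10 Ω) (hu : ∫ x in K, val u x = 0) :
    ∫ x in K, ‖val u x‖ ^ 2 ≤ (2 * H / Real.pi) ^ 2 * ∫ x in K, ‖grad u x‖ ^ 2 := by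
  have hKt : (volume.restrict Ω) K ≠ ⊤ :=
    ((Measure.restrict_apply_le _ _).trans_lt hKb.measure_lt_top).ne
  have hmean : ∀ v : L2 Ω, inner ℝ (indicatorConstLp 2 hKo.measurableSet hKt (1 : ℝ)) v =
      ∫ x in K, v x := fun v => by
    rw [L2.inner_indicatorConstLp_one, Measure.restrict_restrict_of_subset hKΩ]
  have key := H10_induction (P := fun p =>
    ‖LpToLpRestrictCLM _ ℝ ℝ (volume.restrict Ω) 2 K p.fst‖ ^ 2 ≤
      (2 * H / Real.pi) ^ 2 *
        ‖LpToLpRestrictCLM _ (EuclideanSpace ℝ (Fin d)) ℝ (volume.restrict Ω) 2 K p.snd‖ ^ 2 +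
      (inner ℝ (indicatorConstLp 2 hKo.measurableSet hKt (1 : ℝ)) p.fst) ^ 2 / volume.real K)
    (isClosed_le (by fun_prop) (by fun_prop)) (fun p η h1 h2 h3 h4 h5 => by
      have hr : ∀ {P : EuclideanSpace ℝ (Fin d) → Prop}, (∀ᵐ x ∂(volume.restrict Ω), P x) →
          ∀ᵐ x ∂(volume.restrict K), P x := fun h => ae_restrict_of_ae_restrict_of_subset hKΩ h
      rw [norm_sq_restrict hKΩ, norm_sq_restrict hKΩ, hmean]
      have e1 : ∫ x in K, ‖p.fst x‖ ^ 2 = ∫ x in K, η x ^ 2 := by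
        refine integral_congr_ae ?_
        filter_upwards [hr h4] with x hx
        simp [hx]
      have e2 : ∫ x in K, ‖p.snd x‖ ^ 2 = ∫ x in K, ‖fderiv ℝ η x‖ ^ 2 := by
        refine integral_congr_ae ?_
        filter_upwards [hr h5] with x hx
        simp [hx, norm_gradient]
      rw [e1, e2, integral_congr_ae (hr h4)]
      exact poincare_of_contDiff hd hKo hKc hKb hK0 hH hKH (h1.of_le (by simp))) u
  have hval : (u : L2Pair Ω).fst = val u := rfl
  have hgrad : (u : L2Pair Ω).snd = grad u := rfl
  rw [norm_sq_restrict hKΩ, norm_sq_restrict hKΩ, hmean, hval, hgrad, hu] at key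
  simpa using key

/-- Test functions define elements of `H¹₀`. -/
theorem exists_H10_of_contDiff {η : EuclideanSpace ℝ (Fin d) → ℝ} (h1 : ContDiff ℝ ∞ η)
    (h2 : HasCompactSupport η) (h3 : tsupport η ⊆ Ω) :
    ∃ u : H10 Ω, val u =ᵐ[volume.restrict Ω] η := by
  have hm : MemLp η 2 (volume.restrict Ω) :=
    (h1.continuous.memLp_of_hasCompactSupport h2).restrict _
  have hg : HasCompactSupport (gradient η) := by
    refine (h2.fderiv (𝕜 := ℝ)).mono fun x hx h => hx ?_
    rw [gradient, h, map_zero]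
  have hm' : MemLp (gradient η) 2 (volume.restrict Ω) :=
    ((continuous_gradient (h1.of_le (by simp))).memLp_of_hasCompactSupport hg).restrict _
  have hmem : (WithLp.toLp 2 (hm.toLp η, hm'.toLp (gradient η)) : L2Pair Ω) ∈ testPairs Ω :=
    ⟨η, h1, h2, h3, hm.coeFn_toLp, hm'.coeFn_toLp⟩
  exact ⟨⟨_, (testPairs Ω).le_topologicalClosure hmem⟩, hm.coeFn_toLp⟩

namespace IsConvexPartition

variable {ι : Type} {τ : ι → Set (EuclideanSpace ℝ (Fin d))} {H : ℝ}

/-- The frontier of a convex set is null. Cells, which need not be Borel, can thus be replaced by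
their open interiors. -/
theorem interior_ae_eq (hτ : IsConvexPartition Ω τ H) (i : ι) :
    interior (τ i) =ᵐ[volume] τ i :=
  interior_ae_eq_of_null_frontier ((hτ.convex i).addHaar_frontier volume)

theorem nullMeasurableSet (hτ : IsConvexPartition Ω τ H) (i : ι) :
    NullMeasurableSet (τ i) volume :=
  (isOpen_interior.measurableSet.nullMeasurableSet).congr (hτ.interior_ae_eq i)

theorem volume_interior_pos (hτ : IsConvexPartition Ω τ H) (i : ι) :
    0 < volume (interior (τ i)) := by
  rw [measure_congr (hτ.interior_ae_eq i)]
  exact hτ.volume_pos i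

theorem cellIndicator_ae_eq (hτ : IsConvexPartition Ω τ H) (i : ι) :
    cellIndicator τ i =ᵐ[volume] (interior (τ i)).indicator fun _ => (1 : ℝ) :=
  (indicator_ae_eq_of_ae_eq_set (hτ.interior_ae_eq i)).symm

theorem memLp_cellIndicator (hτ : IsConvexPartition Ω τ H) (hΩb : Bornology.IsBounded Ω) (i : ι) :
    MemLp (cellIndicator τ i) 2 (volume.restrict Ω) := by
  have h : MemLp ((interior (τ i)).indicator fun _ => (1 : ℝ)) 2 volume :=
    memLp_indicator_const 2 isOpen_interior.measurableSet 1
      (Or.inr ((hΩb.subset (interior_subset.trans (hτ.subset i))).measure_lt_top.ne))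
  exact (h.ae_eq (hτ.cellIndicator_ae_eq i).symm).restrict _

theorem measurement_eq (hτ : IsConvexPartition Ω τ H) (i : ι) (u : H10 Ω) :
    measurement (cellIndicator τ i) u = ∫ x in interior (τ i), val u x := by
  have h : ∫ x in Ω, cellIndicator τ i x * val u x =
      ∫ x in Ω, (interior (τ i)).indicator (val u) x := by
    refine integral_congr_ae ?_
    filter_upwards [ae_restrict_of_ae (hτ.cellIndicator_ae_eq i)] with x hx
    rw [hx]
    by_cases h : x ∈ interior (τ i) <;> simp [h]
  rw [measurement, h, setIntegral_indicator isOpen_interior.measurableSet,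
    inter_eq_right.2 (interior_subset.trans (hτ.subset i))]

theorem dist_le (hτ : IsConvexPartition Ω τ H) (hΩb : Bornology.IsBounded Ω) (i : ι)
    {x y : EuclideanSpace ℝ (Fin d)} (hx : x ∈ τ i) (hy : y ∈ τ i) : dist x y ≤ H :=
  (Metric.dist_le_diam_of_mem (hΩb.subset (hτ.subset i)) hx hy).trans (hτ.diam_le i)

theorem mesh_pos (hd : 0 < d) (hτ : IsConvexPartition Ω τ H) (hΩb : Bornology.IsBounded Ω)
    (i : ι) : 0 < H := by
  by_contra! hH
  have hs : (τ i).Subsingleton := fun x hx y hy =>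
    dist_le_zero.1 ((hτ.dist_le hΩb i hx hy).trans hH)
  have : Nonempty (Fin d) := ⟨⟨0, hd⟩⟩
  exact (hτ.volume_pos i).ne' (hs.measure_zero volume)

open Classical in
/-- Dual functions to the indicator functions of the cells. -/
theorem exists_dual (hτ : IsConvexPartition Ω τ H) :
    ∃ η : ι → H10 Ω, ∀ i j, measurement (cellIndicator τ j) (η i) = if i = j then 1 else 0 := by
  have key : ∀ i, ∃ η : H10 Ω, ∀ j, measurement (cellIndicator τ j) η = if i = j then 1 else 0 := by
    intro i
    -- A smooth bump supported inside cell `i`, divided by its integral, has measurement 1 there and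
    -- 0 on the other cells.
    obtain ⟨x, hx⟩ := nonempty_of_measure_ne_zero (hτ.volume_interior_pos i).ne'
    obtain ⟨f, h1, h2, h3, h4, h5⟩ := exists_contDiff_tsupport_subset (n := ⊤)
      (isOpen_interior.mem_nhds hx)
    have hf0 : ∀ x, 0 ≤ f x := fun x => (h4 (mem_range_self x)).1
    have hpos : 0 < ∫ x, f x := h3.continuous.integral_pos_of_hasCompactSupport_nonneg_nonzero
      h2 hf0 (x := x) (by rw [h5]; exact one_ne_zero)
    obtain ⟨u, hu⟩ := exists_H10_of_contDiff h3 h2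
      (h1.trans (interior_subset.trans (hτ.subset i)))
    have hout : ∀ x, x ∉ interior (τ i) → f x = 0 := fun x hx =>
      image_eq_zero_of_notMem_tsupport fun h => hx (h1 h)
    have hmeas : ∀ j, measurement (cellIndicator τ j) u = if i = j then ∫ x, f x else 0 := by
      intro j
      have hint : ∫ x in interior (τ j), val u x = ∫ x in interior (τ j), f x :=
        integral_congr_ae (ae_restrict_of_ae_restrict_of_subset
          (interior_subset.trans (hτ.subset j)) hu)
      rw [hτ.measurement_eq, hint]
      split_ifs with hij
      · subst hij
        exact setIntegral_eq_integral_of_forall_compl_eq_zero hout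
      · have : ∀ᵐ x ∂(volume.restrict (interior (τ j))), f x = 0 := by
          rw [ae_restrict_iff' isOpen_interior.measurableSet]
          filter_upwards [compl_mem_ae_iff.2 (hτ.disjoint i j hij)] with x hx hxj
          exact hout x fun hxi => hx ⟨interior_subset hxi, interior_subset hxj⟩
        exact integral_eq_zero_of_ae this
    refine ⟨(∫ x, f x)⁻¹ • u, fun j => ?_⟩
    have hs : measurement (cellIndicator τ j) ((∫ x, f x)⁻¹ • u) =
        (∫ x, f x)⁻¹ * measurement (cellIndicator τ j) u := by
      rw [measurement, measurement, ← integral_const_mul]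
      refine integral_congr_ae ?_
      filter_upwards [Lp.coeFn_smul (∫ x, f x)⁻¹ (val u)] with x hx
      rw [val_smul, hx]
      simp only [Pi.smul_apply, smul_eq_mul]
      ring
    rw [hs, hmeas]
    split_ifs
    · exact inv_mul_cancel₀ hpos.ne'
    · exact mul_zero _
  choose η hη using key
  exact ⟨η, hη⟩

theorem setIntegral_eq_sum [Fintype ι] (hτ : IsConvexPartition Ω τ H)
    {f : EuclideanSpace ℝ (Fin d) → ℝ} (hf : IntegrableOn f Ω) :
    ∫ x in Ω, f x = ∑ i, ∫ x in interior (τ i), f x := by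
  have hsub : ⋃ i, τ i ⊆ Ω := iUnion_subset hτ.subset
  have hae : Ω =ᵐ[volume] ⋃ i, τ i :=
    (ae_le_set.2 hτ.cover).antisymm (LE.le.eventuallyLE hsub)
  rw [setIntegral_congr_set hae, integral_iUnion_ae hτ.nullMeasurableSet
    (fun i j hij => hτ.disjoint i j hij) (hf.mono_set hsub), tsum_fintype]
  exact Finset.sum_congr rfl fun i _ => (setIntegral_congr_set (hτ.interior_ae_eq i)).symm

/-- The Poincaré inequality for functions with zero mean on the cells of a convex partition. -/
theorem norm_mul_norm_val_le [Fintype ι] (hd : 0 < d) (hΩb : Bornology.IsBounded Ω)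
    (hτ : IsConvexPartition Ω τ H) (g : L2 Ω) (v : H10 Ω)
    (hv : ∀ i, measurement (cellIndicator τ i) v = 0) :
    ‖g‖ * ‖val v‖ ≤ ‖g‖ * (2 * H / Real.pi * ‖grad v‖) := by
  -- With no cells, `Ω` is null and `H` may be negative; the factor `‖g‖ = 0` on both sides keeps
  -- the inequality true.
  rcases isEmpty_or_nonempty ι with hι | ⟨⟨i₀⟩⟩
  · have h0 : volume Ω = 0 := by simpa using hτ.cover
    have hg : ‖g‖ = 0 := by
      have : ‖g‖ ^ 2 = 0 := by
        rw [norm_sq_eq_integral, setIntegral_measure_zero _ h0]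
      simpa using this
    simp [hg]
  · have hH := hτ.mesh_pos hd hΩb i₀
    refine mul_le_mul_of_nonneg_left ?_ (norm_nonneg g)
    refine (sq_le_sq₀ (norm_nonneg _) (by positivity)).1 ?_
    rw [mul_pow, norm_sq_eq_integral, norm_sq_eq_integral,
      hτ.setIntegral_eq_sum (integrable_norm_sq _), hτ.setIntegral_eq_sum (integrable_norm_sq _),
      Finset.mul_sum]
    refine Finset.sum_le_sum fun i _ => ?_
    refine poincare_H10 hd isOpen_interior (hτ.convex i).interior
      (hΩb.subset (interior_subset.trans (hτ.subset i))) (hτ.volume_interior_pos i).ne' hH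
      (fun x hx y hy => hτ.dist_le hΩb i (interior_subset hx) (interior_subset hy))
      (interior_subset.trans (hτ.subset i)) v ?_
    rw [← hτ.measurement_eq, hv]

end IsConvexPartition

end Cells

/-! ### Gamblets -/

section Gamblets

variable {d : ℕ} {Ω : Set (EuclideanSpace ℝ (Fin d))}
  {a : EuclideanSpace ℝ (Fin d) → Matrix (Fin d) (Fin d) ℝ} {lmin lmax : ℝ}
  {ι : Type} [Fintype ι] {τ : ι → Set (EuclideanSpace ℝ (Fin d))} {H : ℝ}

open Classical in
/-- The gamblets are the unique dual functions to the measurements in the span of the functions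
`𝓛⁻¹ φ_i`. -/
theorem exists_isGamblets_iff_eq (hd : 0 < d) (hΩb : Bornology.IsBounded Ω)
    (ha : IsElliptic Ω a lmin lmax) (hτ : IsConvexPartition Ω τ H) {w : ι → H10 Ω}
    (hw : ∀ i, IsWeakSolution a (cellIndicator τ i) (w i)) :
    ∃ ψ₀ : ι → H10 Ω, (∀ i, ψ₀ i ∈ Submodule.span ℝ (range w)) ∧
      (∀ i j, measurement (cellIndicator τ j) (ψ₀ i) = if i = j then 1 else 0) ∧
      ∀ ψ : ι → H10 Ω, IsGamblets a (cellIndicator τ) ψ ↔ ψ = ψ₀ := by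
  let ℓ : ι → H10 Ω →ₗ[ℝ] ℝ := fun i => (measurementCLM (hτ.memLp_cellIndicator hΩb i)).toLinearMap
  have hℓ : ∀ i v, ℓ i v = measurement (cellIndicator τ i) v := fun i v =>
    measurementCLM_apply _ v
  have hw' : ∀ i v, energyForm ha v (w i) = ℓ i v := fun i v => (hw i v).trans (hℓ i v).symm
  have hp := energyForm_pos hd hΩb ha
  have hs := energyForm_comm ha
  -- The dual family makes the constraints attainable. An admissible function then differs from `ψ₀
  -- i` by one with zero measurements, so its energy splits, and `ψ₀ i` is the strict minimizer.
  obtain ⟨η, hη⟩ := hτ.exists_dual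
  obtain ⟨ψ₀, hmem, hdual⟩ := exists_dual_mem_span hp hw' (η := η)
    (fun i j => (hℓ j _).trans (hη i j))
  have hpyth : ∀ i (η : H10 Ω), IsAdmissible (cellIndicator τ) i η →
      energyForm ha η η = energyForm ha (η - ψ₀ i) (η - ψ₀ i) + energyForm ha (ψ₀ i) (ψ₀ i) := by
    intro i η hη
    have := form_pythagoras hs hw' (u := η - ψ₀ i) (fun j => by
      rw [map_sub, hdual, hℓ, hη j, sub_self]) (hmem i)
    rwa [sub_add_cancel] at this
  have hnn : ∀ v, 0 ≤ energyForm ha v v := fun v => by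
    rcases eq_or_ne v 0 with rfl | hv
    · simp
    · exact (hp v hv).le
  have hadm : ∀ i, IsAdmissible (cellIndicator τ) i (ψ₀ i) := fun i j =>
    (hℓ j _).symm.trans (hdual i j)
  refine ⟨ψ₀, hmem, fun i j => hadm i j, fun ψ => ⟨fun hψ => funext fun i => ?_, ?_⟩⟩
  · by_contra hne
    have h1 : energyForm ha (ψ i) (ψ i) ≤ energyForm ha (ψ₀ i) (ψ₀ i) :=
      (Real.sqrt_le_sqrt_iff (hnn _)).1 ((hψ i).2 _ (hadm i))
    have h2 := hpyth i _ (hψ i).1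
    have h3 := hp _ (sub_ne_zero.2 hne)
    linarith
  · rintro rfl i
    refine ⟨hadm i, fun η hη => Real.sqrt_le_sqrt ?_⟩
    have := hpyth i η hη
    have := hnn (η - ψ i)
    simp only [energyForm_apply] at *
    linarith

omit [Fintype ι] in
theorem exists_weakSolutions (hd : 0 < d) (hΩb : Bornology.IsBounded Ω)
    (ha : IsElliptic Ω a lmin lmax) (hτ : IsConvexPartition Ω τ H) :
    ∃ w : ι → H10 Ω, ∀ i, IsWeakSolution a (cellIndicator τ i) (w i) := by
  choose w hw using fun i =>
    (existsUnique_isWeakSolution hd hΩb ha (hτ.memLp_cellIndicator hΩb i)).exists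
  exact ⟨w, hw⟩

omit [Fintype ι] in
theorem solutionSpan_eq (hd : 0 < d) (hΩb : Bornology.IsBounded Ω)
    (ha : IsElliptic Ω a lmin lmax) (hτ : IsConvexPartition Ω τ H) {w : ι → H10 Ω}
    (hw : ∀ i, IsWeakSolution a (cellIndicator τ i) (w i)) :
    solutionSpan Ω a (cellIndicator τ) = Submodule.span ℝ (range w) := by
  rw [solutionSpan]
  congr 1
  ext v
  constructor
  · rintro ⟨i, hi⟩
    exact ⟨i, (existsUnique_isWeakSolution hd hΩb ha (hτ.memLp_cellIndicator hΩb i)).unique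
      (hw i) hi⟩
  · rintro ⟨i, rfl⟩
    exact ⟨i, hw i⟩

theorem span_gamblets_eq (hd : 0 < d) (hΩb : Bornology.IsBounded Ω)
    (ha : IsElliptic Ω a lmin lmax) (hτ : IsConvexPartition Ω τ H) {ψ : ι → H10 Ω}
    (hψ : IsGamblets a (cellIndicator τ) ψ) :
    Submodule.span ℝ (range ψ) = solutionSpan Ω a (cellIndicator τ) := by
  obtain ⟨w, hw⟩ := exists_weakSolutions hd hΩb ha hτ
  obtain ⟨ψ₀, hmem, hdual, hiff⟩ := exists_isGamblets_iff_eq hd hΩb ha hτ hw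
  obtain rfl := (hiff ψ).1 hψ
  rw [solutionSpan_eq hd hΩb ha hτ hw]
  exact span_dual_eq (B := energyForm ha)
    (ℓ := fun i => (measurementCLM (hτ.memLp_cellIndicator hΩb i)).toLinearMap)
    (energyForm_pos hd hΩb ha) (fun i v => (hw i v).trans (measurementCLM_apply _ v).symm) hmem
    fun i j => (measurementCLM_apply _ _).trans (hdual i j)

theorem recovery_mem_span (φ : ι → EuclideanSpace ℝ (Fin d) → ℝ) (ψ : ι → H10 Ω) (u : H10 Ω) :
    recovery φ ψ u ∈ Submodule.span ℝ (range ψ) :=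
  Submodule.sum_mem _ fun i _ => Submodule.smul_mem _ _ (Submodule.subset_span ⟨i, rfl⟩)

theorem measurement_sub_recovery (hΩb : Bornology.IsBounded Ω) (hτ : IsConvexPartition Ω τ H)
    {ψ : ι → H10 Ω} (hψ : ∀ i, IsAdmissible (cellIndicator τ) i (ψ i)) (u : H10 Ω) (j : ι) :
    measurement (cellIndicator τ j) (u - recovery (cellIndicator τ) ψ u) = 0 := by
  rw [← measurementCLM_apply (hτ.memLp_cellIndicator hΩb j), map_sub, recovery, map_sum]
  simp only [map_smul, measurementCLM_apply, hψ _ j, smul_eq_mul]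
  rw [Finset.sum_eq_single j (fun i _ hij => by rw [if_neg hij, mul_zero]) (by simp), if_pos rfl,
    mul_one, sub_self]

/-- The recovery is the best approximation in the energy norm. -/
theorem energyNorm_sub_recovery_eq_iInf (hd : 0 < d) (hΩb : Bornology.IsBounded Ω)
    (ha : IsElliptic Ω a lmin lmax) (hτ : IsConvexPartition Ω τ H) {ψ : ι → H10 Ω}
    (hψ : IsGamblets a (cellIndicator τ) ψ) (u : H10 Ω) :
    energyNorm a (u - recovery (cellIndicator τ) ψ u) =
      ⨅ v : Submodule.span ℝ (range ψ), energyNorm a (u - (v : H10 Ω)) := by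
  obtain ⟨w, hw⟩ := exists_weakSolutions hd hΩb ha hτ
  have hspan := (span_gamblets_eq hd hΩb ha hτ hψ).trans (solutionSpan_eq hd hΩb ha hτ hw)
  have hmem := recovery_mem_span (cellIndicator τ) ψ u
  rw [hspan] at hmem ⊢
  exact sqrt_form_eq_iInf (B := energyForm ha)
    (ℓ := fun i => (measurementCLM (hτ.memLp_cellIndicator hΩb i)).toLinearMap)
    (energyForm_comm ha) (energyForm_pos hd hΩb ha)
    (fun i v => (hw i v).trans (measurementCLM_apply _ v).symm) hmem
    fun j => (measurementCLM_apply _ _).trans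
      (measurement_sub_recovery hΩb hτ (fun i => (hψ i).1) u j)

/-- The error `v` is orthogonal to the recovery, so $\|v\|_a^2=\int gv$; Poincaré on the cells
bounds this by $\|g\|\,(2H/\pi)\,\|\nabla v\|$, and $\sqrt{\lambda_{\min}}\,\|\nabla v\|\le\|v\|_a$
allows one factor $\|v\|_a$ to be divided out. -/
theorem energyNorm_sub_recovery_le (hd : 0 < d) (hΩb : Bornology.IsBounded Ω)
    (ha : IsElliptic Ω a lmin lmax) (hτ : IsConvexPartition Ω τ H) {ψ : ι → H10 Ω}
    (hψ : IsGamblets a (cellIndicator τ) ψ) {g : L2 Ω} {u : H10 Ω} (hu : IsWeakSolution a g u) :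
    energyNorm a (u - recovery (cellIndicator τ) ψ u) ≤
      2 / (Real.pi * Real.sqrt lmin) * H * ‖g‖ := by
  obtain ⟨w, hw⟩ := exists_weakSolutions hd hΩb ha hτ
  have hspan := (span_gamblets_eq hd hΩb ha hτ hψ).trans (solutionSpan_eq hd hΩb ha hτ hw)
  have hmem := recovery_mem_span (cellIndicator τ) ψ u
  rw [hspan] at hmem
  set v := u - recovery (cellIndicator τ) ψ u with hv
  have hv0 : ∀ j, measurement (cellIndicator τ j) v = 0 :=
    measurement_sub_recovery hΩb hτ (fun i => (hψ i).1) u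
  have horth : energyForm ha v (recovery (cellIndicator τ) ψ u) = 0 :=
    form_eq_zero_of_mem_span
      (ℓ := fun i => (measurementCLM (hτ.memLp_cellIndicator hΩb i)).toLinearMap)
      (fun i v => (hw i v).trans (measurementCLM_apply _ v).symm)
      (fun j => (measurementCLM_apply _ _).trans (hv0 j)) hmem
  have hE : energyForm ha v v = measurement g v := by
    have h1 : energyForm ha v u = measurement g v := hu v
    conv_lhs => rw [hv, map_sub, ← hv]
    rw [horth, h1, sub_zero]
  have hpos := ha.pos
  have hs : 0 < Real.sqrt lmin := Real.sqrt_pos.2 hpos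
  set N := energyNorm a v with hN
  have hN0 : 0 ≤ N := Real.sqrt_nonneg _
  have hgrad0 := lmin_mul_norm_grad_sq_le ha v
  have hNsq : N ^ 2 = energyForm ha v v :=
    Real.sq_sqrt ((mul_nonneg hpos.le (sq_nonneg _)).trans hgrad0)
  have hgrad : ‖grad v‖ * Real.sqrt lmin ≤ N := by
    refine (sq_le_sq₀ (by positivity) hN0).1 ?_
    rw [mul_pow, Real.sq_sqrt hpos.le, hNsq]
    linarith
  have hchain : N ^ 2 ≤ ‖g‖ * (2 * H / Real.pi * ‖grad v‖) := by
    rw [hNsq, hE]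
    exact (le_abs_self _).trans ((abs_measurement_le g v).trans
      (hτ.norm_mul_norm_val_le hd hΩb g v hv0))
  have hπ := Real.pi_pos
  -- Without cells the sign of `H` is unknown, but `‖g‖ = 0` forces `N = 0`.
  rcases isEmpty_or_nonempty ι with hι | ⟨⟨i₀⟩⟩
  · have h0 : volume Ω = 0 := by simpa using hτ.cover
    have hg : ‖g‖ = 0 := by
      have : ‖g‖ ^ 2 = 0 := by
        rw [norm_sq_eq_integral, setIntegral_measure_zero _ h0]
      simpa using this
    rw [hg, zero_mul] at hchain
    rw [hg, mul_zero]
    nlinarith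
  · have hH := hτ.mesh_pos hd hΩb i₀
    have h2 : N ^ 2 ≤ 2 / (Real.pi * Real.sqrt lmin) * H * ‖g‖ * N := by
      calc N ^ 2 ≤ ‖g‖ * (2 * H / Real.pi * ‖grad v‖) := hchain
        _ = 2 / (Real.pi * Real.sqrt lmin) * H * ‖g‖ * (‖grad v‖ * Real.sqrt lmin) := by
            field_simp
        _ ≤ _ := mul_le_mul_of_nonneg_left hgrad (by positivity)
    rcases hN0.eq_or_lt with h | h
    · rw [← h]; positivity
    · rw [sq] at h2
      exact le_of_mul_le_mul_right h2 h

end Gamblets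

/-! ### Nested partitions -/

section Nested

variable {d : ℕ} {Ω : Set (EuclideanSpace ℝ (Fin d))}
  {a : EuclideanSpace ℝ (Fin d) → Matrix (Fin d) (Fin d) ℝ} {lmin lmax : ℝ}

theorem integrableOn_val (hΩb : Bornology.IsBounded Ω) (u : H10 Ω) : IntegrableOn (val u) Ω := by
  have : IsFiniteMeasure (volume.restrict Ω) := isFiniteMeasure_restrict.2 hΩb.measure_lt_top.ne
  exact (Lp.memLp (val u)).integrable (by norm_num)

/-- Measurements by the indicator function of a union of cells. -/
theorem measurement_eq_sum {ι κ : Type} [Fintype κ] {τ : ι → Set (EuclideanSpace ℝ (Fin d))}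
    {σ : κ → Set (EuclideanSpace ℝ (Fin d))} {H H' : ℝ} (hΩb : Bornology.IsBounded Ω)
    (hτ : IsConvexPartition Ω τ H) (hσ : IsConvexPartition Ω σ H') (i : ι) (p : κ → Prop)
    [DecidablePred p] (h : τ i =ᵐ[volume] ⋃ j, ⋃ _ : p j, σ j) (u : H10 Ω) :
    measurement (cellIndicator τ i) u =
      ∑ j : {j // p j}, measurement (cellIndicator σ (j : κ)) u := by
  have hsub : ⋃ j : {j // p j}, σ j ⊆ Ω := iUnion_subset fun j => hσ.subset j
  have h' : τ i =ᵐ[volume] ⋃ j : {j // p j}, σ j := by rwa [iUnion_subtype]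
  simp only [hτ.measurement_eq, hσ.measurement_eq]
  rw [setIntegral_congr_set ((hτ.interior_ae_eq i).trans h'),
    integral_iUnion_ae (s := fun j : {j // p j} => σ j) (fun j => hσ.nullMeasurableSet j)
      (fun j k hjk => hσ.disjoint j k fun h => hjk (Subtype.ext h))
      ((integrableOn_val hΩb u).mono_set hsub), tsum_fintype]
  exact Finset.sum_congr rfl fun j _ => (setIntegral_congr_set (hσ.interior_ae_eq j)).symm

/-- By linearity and uniqueness, the solution for a coarse indicator is the sum of the solutions for
the fine cells composing it. -/
theorem solutionSpan_le_of_refinement {ι κ : Type} [Fintype κ]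
    {τ : ι → Set (EuclideanSpace ℝ (Fin d))} {σ : κ → Set (EuclideanSpace ℝ (Fin d))} {H H' : ℝ}
    (hd : 0 < d) (hΩb : Bornology.IsBounded Ω) (ha : IsElliptic Ω a lmin lmax)
    (hτ : IsConvexPartition Ω τ H) (hσ : IsConvexPartition Ω σ H') (p : ι → κ → Prop)
    (h : ∀ i, τ i =ᵐ[volume] ⋃ j, ⋃ _ : p i j, σ j) :
    solutionSpan Ω a (cellIndicator τ) ≤ solutionSpan Ω a (cellIndicator σ) := by
  classical
  obtain ⟨w, hw⟩ := exists_weakSolutions hd hΩb ha hσ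
  rw [solutionSpan_eq hd hΩb ha hσ hw, solutionSpan, Submodule.span_le]
  rintro v ⟨i, hi⟩
  have hsum : IsWeakSolution a (cellIndicator τ i) (∑ j : {j // p i j}, w j) := fun u => by
    have h1 := measurement_eq_sum hΩb hτ hσ i (p i) (h i) u
    have h2 : energyForm ha u (∑ j : {j // p i j}, w j) =
        ∑ j : {j // p i j}, measurement (cellIndicator σ (j : κ)) u := by
      rw [map_sum]
      exact Finset.sum_congr rfl fun j _ => hw j u
    exact h2.trans h1.symm
  rw [(existsUnique_isWeakSolution hd hΩb ha (hτ.memLp_cellIndicator hΩb i)).unique hi hsum]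
  exact Submodule.sum_mem _ fun j _ => Submodule.subset_span ⟨j, rfl⟩

end Nested

end Gamblet

end

/-! ### The main theorem -/

theorem mainTheorem3 {d : ℕ} (hd : 0 < d) (Ω : Set (EuclideanSpace ℝ (Fin d)))
    (hΩ : IsOpen Ω) (hΩb : Bornology.IsBounded Ω)
    (a : EuclideanSpace ℝ (Fin d) → Matrix (Fin d) (Fin d) ℝ) (lmin lmax : ℝ)
    (ha : Gamblet.IsElliptic Ω a lmin lmax) :
    -- the boundary value problem has exactly one weak solution
    (∀ g : Gamblet.L2 Ω, ∃! u : Gamblet.H10 Ω, Gamblet.IsWeakSolution a g u) ∧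
    -- one level
    (∀ (ι : Type) [Fintype ι] (τ : ι → Set (EuclideanSpace ℝ (Fin d))) (H : ℝ),
      Gamblet.IsConvexPartition Ω τ H →
      (∃! ψ : ι → Gamblet.H10 Ω, Gamblet.IsGamblets a (Gamblet.cellIndicator τ) ψ) ∧
      ∀ ψ : ι → Gamblet.H10 Ω, Gamblet.IsGamblets a (Gamblet.cellIndicator τ) ψ →
        ∀ (g : Gamblet.L2 Ω) (u : Gamblet.H10 Ω), Gamblet.IsWeakSolution a g u →
          (⨅ v : Submodule.span ℝ (Set.range ψ), Gamblet.energyNorm a (u - (v : Gamblet.H10 Ω))) ≤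
            2 / (Real.pi * Real.sqrt lmin) * H * ‖g‖ ∧
          Gamblet.recovery (Gamblet.cellIndicator τ) ψ u ∈ Submodule.span ℝ (Set.range ψ) ∧
          Gamblet.energyNorm a (u - Gamblet.recovery (Gamblet.cellIndicator τ) ψ u) =
            ⨅ v : Submodule.span ℝ (Set.range ψ), Gamblet.energyNorm a (u - (v : Gamblet.H10 Ω))) ∧
    -- several levels
    (∀ (q : ℕ) (I : Finset (List ℕ))
      (τ : (k : ℕ) → Gamblet.level I k → Set (EuclideanSpace ℝ (Fin d))) (H : ℕ → ℝ),
      Gamblet.IsNestedPartition Ω q I τ H →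
      ∀ ψ : (k : ℕ) → Gamblet.level I k → Gamblet.H10 Ω,
        (∀ k, 1 ≤ k → k ≤ q → Gamblet.IsGamblets a (Gamblet.cellIndicator (τ k)) (ψ k)) →
        ∀ k, 1 ≤ k → k ≤ q →
          Gamblet.gambletSpace q ψ k ≤ Gamblet.gambletSpace q ψ (k + 1) ∧
          Gamblet.gambletSpace q ψ k =
            Gamblet.solutionSpan Ω a (Gamblet.cellIndicator (τ k)) ∧
          ∀ (g : Gamblet.L2 Ω) (u : Gamblet.H10 Ω), Gamblet.IsWeakSolution a g u →
            Gamblet.recovery (Gamblet.cellIndicator (τ k)) (ψ k) u ∈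
              Gamblet.gambletSpace q ψ k ∧
            Gamblet.energyNorm a
                (u - Gamblet.recovery (Gamblet.cellIndicator (τ k)) (ψ k) u) =
              (⨅ v : Gamblet.gambletSpace q ψ k, Gamblet.energyNorm a (u - (v : Gamblet.H10 Ω))) ∧
            (⨅ v : Gamblet.gambletSpace q ψ k, Gamblet.energyNorm a (u - (v : Gamblet.H10 Ω))) ≤
              2 / (Real.pi * Real.sqrt lmin) * H k * ‖g‖) := by
  
  refine ⟨fun g => Gamblet.existsUnique_isWeakSolution hd hΩb ha (Lp.memLp g), ?_, ?_⟩
  · intro ι _ τ H hτ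
    obtain ⟨w, hw⟩ := Gamblet.exists_weakSolutions hd hΩb ha hτ
    obtain ⟨ψ₀, -, -, hψ₀⟩ := Gamblet.exists_isGamblets_iff_eq hd hΩb ha hτ hw
    refine ⟨⟨ψ₀, (hψ₀ ψ₀).2 rfl, fun ψ hψ => (hψ₀ ψ).1 hψ⟩, fun ψ hψ g u hu => ?_⟩
    have h := Gamblet.energyNorm_sub_recovery_eq_iInf hd hΩb ha hτ hψ u
    refine ⟨?_, Gamblet.recovery_mem_span _ ψ u, h⟩
    rw [← h]
    exact Gamblet.energyNorm_sub_recovery_le hd hΩb ha hτ hψ hu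
  · intro q I τ H hτ ψ hψ k hk1 hkq
    have hτk := hτ.partition k hk1 hkq
    have hψk := hψ k hk1 hkq
    have hspace : Gamblet.gambletSpace q ψ k = Submodule.span ℝ (Set.range (ψ k)) := if_pos hkq
    have hsol := Gamblet.span_gamblets_eq hd hΩb ha hτk hψk
    refine ⟨?_, hspace.trans hsol, fun g u hu => ?_⟩
    · rcases hkq.eq_or_lt with hkq' | hkq'
      -- At the finest level `k = q` the next space is all of $H^1_0(\Omega)$.
      · have : Gamblet.gambletSpace q ψ (k + 1) = ⊤ := if_neg (by omega)
        rw [this]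
        exact le_top
      · have hspace' : Gamblet.gambletSpace q ψ (k + 1) =
            Submodule.span ℝ (Set.range (ψ (k + 1))) := if_pos hkq'
        rw [hspace, hspace', hsol, Gamblet.span_gamblets_eq hd hΩb ha
          (hτ.partition (k + 1) (by omega) hkq') (hψ (k + 1) (by omega) hkq')]
        exact Gamblet.solutionSpan_le_of_refinement hd hΩb ha hτk
          (hτ.partition (k + 1) (by omega) hkq') _ (hτ.nested k hk1 hkq')
    · rw [hspace]
      have h := Gamblet.energyNorm_sub_recovery_eq_iInf hd hΩb ha hτk hψk u
      refine ⟨Gamblet.recovery_mem_span _ _ u, h, ?_⟩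
      rw [← h]
      exact Gamblet.energyNorm_sub_recovery_le hd hΩb ha hτk hψk hu
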